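/- Let $G$ be a finite group and $\omega\colon G^3\to\mathbb C^\times$ a normalized $3$-cocycle, i.e. $\omega(h,k,l)\,\omega(g,hk,l)\,\omega(g,h,k)=\omega(gh,k,l)\,\omega(g,h,kl)$, and $\omega=1$ whenever one argument is $1$. Write $g\triangleright h=ghg^{-1}$, $[g,h]=ghg^{-1}h^{-1}$, and $\overline g$ for the conjugacy class of $g$. Let $\mathrm{Vect}_G^\omega$ be the category of finite-dimensional $G$-graded complex vector spaces with associativity constraint $(u\otimes v)\otimes w\mapsto\omega(|u|,|v|,|w|)\,u\otimes(v\otimes w)$, and let $\mathcal Z(\mathrm{Vect}_G^\omega)$ be its right Drinfeld center: an object is an object $W$ of $\mathrm{Vect}_G^\omega$ with half-braidings $\sigma_{V,W}\colon V\otimes W\to W\otimes V$, natural in $V$ and compatible with tensor products in $V$; these are also the braidings of the center. The half-braidings have the form $\sigma_{V,W}(v\otimes w)=(|v|\triangleright w)\otimes v$ for linear maps $x\triangleright\colon W\to W$ ($x\in G$), which satisfy $x\triangleright(y\triangleright w)=\alpha_{|w|}(x,y)\,(xy)\triangleright w$ with $$\alpha_g(x,y)=\omega(x,y,g)^{-1}\,\omega(x,y\triangleright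 g,y)\,\omega(xy\triangleright g,x,y)^{-1}.$$ A simple object $W$ is said to be parametrized by $(g,\chi)$ if $W_g\neq 0$ and $\chi(c)=\mathrm{tr}(c\triangleright|_{W_g})$ for all $c\in C_G(g)$; thus $\chi$ is an irreducible $\alpha_g$-projective character of $C_G(g)$. For $p\in G$ and $c\in C_G(p\triangleright g)$ put $$(p\triangleright\chi)(c)=\alpha_g(c,p)\,\alpha_g(p,p^{-1}\triangleright c)^{-1}\,\chi(p^{-1}\triangleright c).$$ For objects $U,V,W$ of the center let $R(\sigma_2^{-1}\sigma_1)\colon(U\otimes V)\otimes W\to(V\otimes W)\otimes U$ be the composite (with associativity constraints inserted) of $\sigma_{U,V}\otimes W$ followed by $V\otimes\sigma_{W,U}^{-1}$. The Borromean tensor is $B_{U,V,W}=\mathrm{ptr}\bigl(R((\sigma_2^{-1}\sigma_1)^3)\bigr)$, the pivotal trace of the automorphism of $(U\otimes V)\otimes W$ obtained by applying this three times, cyclically permuting the objects; for the canonical pivotal structure (categorical dimensions equal to vector space dimensions) this is the trace of the underlying linear map. Define $$\psi(x,x',y,z)=\omega(y,z,x')^{-1}\,\omega(y,x,z)\,\alpha_x(z,z^{-1})^{-1},$$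 $$\begin{aligned}\Omega(x,y,z)={}&\psi(x,\,z^{-1}\triangleright x,\,x\triangleright y,\,z)\;\psi(x\triangleright y,\,y,\,y\triangleright z,\,z^{-1}\triangleright x)\;\psi(y\triangleright z,\,z,\,x,\,y)\\&\cdot\alpha_y\bigl((z^{-1}\triangleright x)^{-1},x\bigr)\,\alpha_x(y\triangleright z,z^{-1})\,\alpha_z(y^{-1},x\triangleright y).\end{aligned}$$ Then for all simple objects $U,V,W$ of $\mathcal Z(\mathrm{Vect}_G^\omega)$ parametrized by $(g,\chi_1)$, $(h,\chi_2)$, $(k,\chi_3)$ respectively, $$B_{U,V,W}=\frac{|\overline g|\,|\overline h|\,|\overline k|}{|G|^2}\sum_{p,q}\Omega(p\triangleright g,q\triangleright h,k)\;(p\triangleright\chi_1)\bigl([q\triangleright h,k]\bigr)\;(q\triangleright\chi_2)\bigl([k^{-1},(p\triangleright g)^{-1}]\bigr)\;\chi_3\bigl([(q\triangleright h)^{-1},p\triangleright g]\bigr),$$ where the sum runs over all $(p,q)\in G\times G$ with $$[[k,q\triangleright h],p\triangleright g]=1\quad\text{and}\quad[[(q\triangleright h)^{-1},p\triangleright g],k]=1$$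 (these conditions guarantee that the three characters are evaluated at elements of the centralizers of $p\triangleright g$, $q\triangleright h$ and $k$). -/

import Mathlib

open CategoryTheory MonoidalCategory TensorProduct
open scoped commutatorElement

noncomputable section

universe u v

/-! ### Right half-braidings and the right Drinfeld center of a monoidal category -/

/-- A right half-braiding on `W`: isomorphisms `σ V : V ⊗ W ≅ W ⊗ V`, natural in `V` and
compatible with tensor products in `V`.  (Compatibility with the unit object follows.) -/
structure RightHalfBraiding {C : Type u} [Category.{v} C] [MonoidalCategory C] (W : C) where
  σ : ∀ V : C, V ⊗ W ≅ W ⊗ V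
  naturality : ∀ {V V' : C} (f : V ⟶ V'), (f ▷ W) ≫ (σ V').hom = (σ V).hom ≫ (W ◁ f)
  monoidal : ∀ V V' : C, (σ (V ⊗ V')).hom =
    (α_ V V' W).hom ≫ (V ◁ (σ V').hom) ≫ (α_ V W V').inv ≫ ((σ V).hom ▷ V') ≫ (α_ W V V').hom

/-- The right Drinfeld center: objects of `C` with a right half-braiding. -/
structure RightCenter (C : Type u) [Category.{v} C] [MonoidalCategory C] where
  obj : C
  hb : RightHalfBraiding obj

namespace RightCenter

variable {C : Type u} [Category.{v} C] [MonoidalCategory C]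

/-- Morphisms of the right center: morphisms of `C` commuting with the half-braidings. -/
@[ext]
structure Hom (X Y : RightCenter C) where
  f : X.obj ⟶ Y.obj
  comm : ∀ V : C, (V ◁ f) ≫ (Y.hb.σ V).hom = (X.hb.σ V).hom ≫ (f ▷ V)

instance : Category (RightCenter C) where
  Hom X Y := Hom X Y
  id X := ⟨𝟙 X.obj, fun V => by simp⟩
  comp f g := ⟨f.f ≫ g.f, fun V => by
    rw [MonoidalCategory.whiskerLeft_comp, Category.assoc, g.comm, ← Category.assoc, f.comm,
      Category.assoc, comp_whiskerRight]⟩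
  id_comp f := Hom.ext (Category.id_comp f.f)
  comp_id f := Hom.ext (Category.comp_id f.f)
  assoc f g h := Hom.ext (Category.assoc f.f g.f h.f)

/-- The braiding of the right center, as a morphism of `C`: `σ_{X,Y} : X ⊗ Y ≅ Y ⊗ X`
is the half-braiding of `Y` evaluated at the object underlying `X`. -/
def braid (X Y : RightCenter C) : X.obj ⊗ Y.obj ≅ Y.obj ⊗ X.obj := Y.hb.σ X.obj

/-- The image of the braid word `σ₂⁻¹σ₁` on `(X ⊗ Y) ⊗ Z`: first `σ_{X,Y}` on the first two
strands, then the inverse braiding `(σ_{Z,X})⁻¹ : X ⊗ Z ⟶ Z ⊗ X` on the last two strands. -/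
def braidStep (X Y Z : RightCenter C) :
    (X.obj ⊗ Y.obj) ⊗ Z.obj ⟶ (Y.obj ⊗ Z.obj) ⊗ X.obj :=
  ((braid X Y).hom ▷ Z.obj) ≫ (α_ Y.obj X.obj Z.obj).hom ≫
    (Y.obj ◁ (braid Z X).inv) ≫ (α_ Y.obj Z.obj X.obj).inv

/-- The image of the Borromean braid `(σ₂⁻¹σ₁)³` on `(X ⊗ Y) ⊗ Z`. -/
def borromeanBraid (X Y Z : RightCenter C) :
    (X.obj ⊗ Y.obj) ⊗ Z.obj ⟶ (X.obj ⊗ Y.obj) ⊗ Z.obj :=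
  braidStep X Y Z ≫ braidStep Y Z X ≫ braidStep Z X Y

end RightCenter

/-! ### The pointed fusion category `Vect_G^ω` -/

/-- A normalized 3-cocycle on `G` with values in `ℂˣ` (trivial action). -/
structure ThreeCocycle (G : Type u) [Group G] where
  toFun : G → G → G → ℂˣ
  cocycle : ∀ g h k l : G, toFun h k l * toFun g (h * k) l * toFun g h k =
    toFun (g * h) k l * toFun g h (k * l)
  normalized : ∀ g h k : G, g = 1 ∨ h = 1 ∨ k = 1 → toFun g h k = 1

instance {G : Type u} [Group G] : CoeFun (ThreeCocycle G) (fun _ => G → G → G → ℂˣ) :=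
  ⟨ThreeCocycle.toFun⟩

/-- An object of `Vect_G^ω`: a finite-dimensional complex vector space with a `G`-grading.  The
grading is given by the projections `proj g` onto the homogeneous components. -/
structure GradedVec {G : Type u} [Group G] [Fintype G] (ω : ThreeCocycle G) where
  carrier : Type
  [addCommGroup : AddCommGroup carrier]
  [module : Module ℂ carrier]
  [finiteDimensional : FiniteDimensional ℂ carrier]
  proj : G → Module.End ℂ carrier
  grading : CompleteOrthogonalIdempotents proj

namespace GradedVec

variable {G : Type u} [Group G] [Fintype G] {ω : ThreeCocycle G}

attribute [instance] addCommGroup module finiteDimensional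

/-- `v` is homogeneous of degree `g`. -/
def Homog (V : GradedVec ω) (g : G) (v : V.carrier) : Prop := V.proj g v = v

/-- Morphisms of `Vect_G^ω`: linear maps preserving degrees. -/
@[ext]
structure Hom (V W : GradedVec ω) where
  toLin : V.carrier →ₗ[ℂ] W.carrier
  comm : ∀ g : G, toLin ∘ₗ V.proj g = W.proj g ∘ₗ toLin

instance : Category (GradedVec ω) where
  Hom V W := Hom V W
  id V := ⟨LinearMap.id, fun _ => rfl⟩
  comp f g := ⟨g.toLin ∘ₗ f.toLin, fun x => by
    rw [LinearMap.comp_assoc, f.comm, ← LinearMap.comp_assoc, g.comm, LinearMap.comp_assoc]⟩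

/-- The linear map underlying a morphism. -/
def lin {V W : GradedVec ω} (f : V ⟶ W) : V.carrier →ₗ[ℂ] W.carrier := Hom.toLin f

theorem hom_ext {V W : GradedVec ω} {f g : V ⟶ W} (h : lin f = lin g) : f = g := Hom.ext h

@[simp] theorem lin_id (V : GradedVec ω) : lin (𝟙 V) = LinearMap.id := rfl
@[simp] theorem lin_comp {V W X : GradedVec ω} (f : V ⟶ W) (g : W ⟶ X) :
    lin (f ≫ g) = lin g ∘ₗ lin f := rfl

theorem lin_proj {V W : GradedVec ω} (f : V ⟶ W) (g : G) (v : V.carrier) :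
    lin f (V.proj g v) = W.proj g (lin f v) := LinearMap.congr_fun (Hom.comm f g) v

theorem Homog.map {V W : GradedVec ω} (f : V ⟶ W) {g : G} {v : V.carrier} (h : V.Homog g v) :
    W.Homog g (lin f v) := by
  unfold Homog at *
  rw [← lin_proj, h]

theorem homog_proj (V : GradedVec ω) (g : G) (v : V.carrier) : V.Homog g (V.proj g v) :=
  LinearMap.congr_fun (V.grading.idem g) v

theorem sum_proj (V : GradedVec ω) (v : V.carrier) : ∑ g, V.proj g v = v := by
  have := LinearMap.congr_fun V.grading.complete v
  simpa using this

theorem Homog.proj_of_ne {V : GradedVec ω} {g h : G} {v : V.carrier} (hv : V.Homog g v)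
    (hne : h ≠ g) : V.proj h v = 0 := by
  have := LinearMap.congr_fun (V.grading.ortho hne) v
  unfold Homog at hv
  simpa [hv] using this

/-- Linear maps agreeing on homogeneous vectors are equal. -/
theorem lin_ext {V : GradedVec ω} {M : Type*} [AddCommGroup M] [Module ℂ M]
    {f f' : V.carrier →ₗ[ℂ] M} (h : ∀ g v, V.Homog g v → f v = f' v) : f = f' := by
  ext v
  rw [← V.sum_proj v, map_sum, map_sum]
  exact Finset.sum_congr rfl fun g _ => h g _ (V.homog_proj g v)

open Classical in
/-- The one-dimensional space `ℂ` placed in degree `x`. -/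
def line (ω : ThreeCocycle G) (x : G) : GradedVec ω where
  carrier := ℂ
  proj g := if g = x then 1 else 0
  grading :=
    { idem := fun g => by by_cases h : g = x <;> simp [h, IsIdempotentElem]
      ortho := fun g h hne => by
        by_cases h1 : g = x
        · have : h ≠ x := fun h2 => hne (h1.trans h2.symm)
          simp [this]
        · simp [h1]
      complete := by simp }

/-- The tensor product: `(V ⊗ W)_g = ⨁_{ab = g} V_a ⊗ W_b`. -/
def tensor (V W : GradedVec ω) : GradedVec ω where
  carrier := V.carrier ⊗[ℂ] W.carrier
  proj g := ∑ a : G, TensorProduct.map (V.proj a) (W.proj (a⁻¹ * g))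
  grading := by
    classical
    have key : ∀ g h : G,
        (∑ a : G, TensorProduct.map (V.proj a) (W.proj (a⁻¹ * g))) *
          (∑ a : G, TensorProduct.map (V.proj a) (W.proj (a⁻¹ * h))) =
        if g = h then ∑ a : G, TensorProduct.map (V.proj a) (W.proj (a⁻¹ * g)) else 0 := by
      intro g h
      rw [Finset.sum_mul_sum]
      have : ∀ a b : G, TensorProduct.map (V.proj a) (W.proj (a⁻¹ * g)) *
          TensorProduct.map (V.proj b) (W.proj (b⁻¹ * h)) =
          if a = b then (if g = h then
            TensorProduct.map (V.proj a) (W.proj (a⁻¹ * g)) else 0) else 0 := by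
        intro a b
        rw [← TensorProduct.map_mul, V.grading.mul_eq, W.grading.mul_eq]
        by_cases hab : a = b
        · subst hab
          by_cases hgh : g = h
          · subst hgh; simp
          · have : ¬ (a⁻¹ * g = a⁻¹ * h) := fun e => hgh (mul_left_cancel e)
            simp [hgh]
        · simp [hab]
      simp only [this, Finset.sum_ite_eq, Finset.mem_univ, if_true]
      split_ifs <;> simp
    refine { idem := fun g => ?_, ortho := fun g h hne => ?_, complete := ?_ }
    · have := key g g
      rw [if_pos rfl] at this
      exact this
    · exact (key g h).trans (if_neg hne)
    · rw [Finset.sum_comm]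
      have : ∀ a : G, ∑ g : G, TensorProduct.map (V.proj a) (W.proj (a⁻¹ * g)) =
          TensorProduct.map (V.proj a) LinearMap.id := by
        intro a
        refine (Fintype.sum_equiv (Equiv.mulLeft a⁻¹) _
          (fun g => TensorProduct.map (V.proj a) (W.proj g)) (fun g => rfl)).trans ?_
        have hc := W.grading.complete
        have h2 := map_sum (TensorProduct.mapBilinear (RingHom.id ℂ) V.carrier W.carrier V.carrier
          W.carrier (V.proj a)) W.proj Finset.univ
        rw [hc] at h2
        exact h2.symm
      simp only [this]
      have hc := V.grading.complete
      have h2 := map_sum ((TensorProduct.mapBilinear (RingHom.id ℂ) V.carrier W.carrier V.carrier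
          W.carrier).flip LinearMap.id) V.proj Finset.univ
      rw [hc] at h2
      refine h2.symm.trans ?_
      exact TensorProduct.map_id

/-- The basis vector of the one-dimensional object `line ω x`. -/
def lineOne (ω : ThreeCocycle G) (x : G) : (line ω x).carrier := (1 : ℂ)

theorem homog_line (x : G) (c : (line ω x).carrier) : (line ω x).Homog x c := by
  have h : (line ω x).proj x = (1 : Module.End ℂ ℂ) := if_pos rfl
  unfold Homog
  rw [h]
  rfl

open Classical in
theorem Homog.proj_apply {V : GradedVec ω} {g : G} {v : V.carrier} (hv : V.Homog g v) (h : G) :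
    V.proj h v = if h = g then v else 0 := by
  split_ifs with e
  · subst e; exact hv
  · exact hv.proj_of_ne e

theorem Homog.smul {V : GradedVec ω} {g : G} {v : V.carrier} (hv : V.Homog g v) (c : ℂ) :
    V.Homog g (c • v) := by
  unfold Homog at *
  rw [map_smul, hv]

theorem comm_at {V W : GradedVec ω} (f : V.carrier →ₗ[ℂ] W.carrier) {g : G} {v : V.carrier}
    (hv : V.Homog g v) (hf : W.Homog g (f v)) (x : G) :
    (f ∘ₗ V.proj x) v = (W.proj x ∘ₗ f) v := by
  classical
  rw [LinearMap.comp_apply, LinearMap.comp_apply, hv.proj_apply, hf.proj_apply]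
  split_ifs
  · rfl
  · exact map_zero f

/-- A linear map sending homogeneous vectors to homogeneous vectors of the same degree is a
morphism. -/
def homOfHomog {V W : GradedVec ω} (f : V.carrier →ₗ[ℂ] W.carrier)
    (h : ∀ g v, V.Homog g v → W.Homog g (f v)) : V ⟶ W :=
  Hom.mk f fun x => lin_ext fun g v hv => comm_at f hv (h g v hv) x

/-- The pure tensor `v ⊗ w`, bilinearly, as an element of the object `tensor V W`. -/
def tmHom (V W : GradedVec ω) : V.carrier →ₗ[ℂ] W.carrier →ₗ[ℂ] (tensor V W).carrier :=
  TensorProduct.mk ℂ V.carrier W.carrier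

/-- The pure tensor `v ⊗ w` as an element of the object `tensor V W`. -/
def tm {V W : GradedVec ω} (v : V.carrier) (w : W.carrier) : (tensor V W).carrier := tmHom V W v w

theorem smul_tm {V W : GradedVec ω} (c : ℂ) (v : V.carrier) (w : W.carrier) :
    tm (c • v) w = c • tm v w := by
  unfold tm; rw [map_smul, LinearMap.smul_apply]

theorem tm_smul {V W : GradedVec ω} (c : ℂ) (v : V.carrier) (w : W.carrier) :
    tm v (c • w) = c • tm v w := map_smul _ _ _

theorem tensor_ext' {V W : GradedVec ω} {M : Type*} [AddCommGroup M] [Module ℂ M]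
    {f f' : (tensor V W).carrier →ₗ[ℂ] M} (h : ∀ v w, f (tm v w) = f' (tm v w)) : f = f' :=
  TensorProduct.ext' h

theorem Homog.tm {V W : GradedVec ω} {a b : G} {v : V.carrier} {w : W.carrier}
    (hv : V.Homog a v) (hw : W.Homog b w) : (tensor V W).Homog (a * b) (tm v w) := by
  classical
  change (∑ c : G, TensorProduct.map (V.proj c) (W.proj (c⁻¹ * (a * b)))) (v ⊗ₜ[ℂ] w) =
    v ⊗ₜ[ℂ] w
  rw [LinearMap.sum_apply, Finset.sum_eq_single a]
  · rw [TensorProduct.map_tmul, hv.proj_apply, hw.proj_apply]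
    simp
  · intro c _ hc
    simp [hv.proj_of_ne hc]
  · simp

theorem tensor_ext {V W : GradedVec ω} {M : Type*} [AddCommGroup M] [Module ℂ M]
    {f f' : (tensor V W).carrier →ₗ[ℂ] M}
    (h : ∀ a b v w, V.Homog a v → W.Homog b w → f (tm v w) = f' (tm v w)) : f = f' := by
  refine tensor_ext' fun v w => ?_
  have : f ∘ₗ tmHom V W v = f' ∘ₗ tmHom V W v := lin_ext fun b w hw => by
    have : f ∘ₗ (tmHom V W).flip w = f' ∘ₗ (tmHom V W).flip w := lin_ext fun a v hv =>
      h a b v w hv hw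
    exact LinearMap.congr_fun this v
  exact LinearMap.congr_fun this w

theorem tensor_ext_left {U V W : GradedVec ω} {M : Type*} [AddCommGroup M] [Module ℂ M]
    {f f' : (tensor (tensor U V) W).carrier →ₗ[ℂ] M}
    (h : ∀ a b c u v w, U.Homog a u → V.Homog b v → W.Homog c w →
      f (tm (tm u v) w) = f' (tm (tm u v) w)) : f = f' := by
  refine tensor_ext' fun t w => ?_
  have : f ∘ₗ tmHom _ W t = f' ∘ₗ tmHom _ W t := lin_ext fun c w hw => by
    have : f ∘ₗ (tmHom _ W).flip w = f' ∘ₗ (tmHom _ W).flip w := tensor_ext fun a b u v hu hv =>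
      h a b c u v w hu hv hw
    exact LinearMap.congr_fun this t
  exact LinearMap.congr_fun this w

theorem tensor_ext_right {U V W : GradedVec ω} {M : Type*} [AddCommGroup M] [Module ℂ M]
    {f f' : (tensor U (tensor V W)).carrier →ₗ[ℂ] M}
    (h : ∀ a b c u v w, U.Homog a u → V.Homog b v → W.Homog c w →
      f (tm u (tm v w)) = f' (tm u (tm v w))) : f = f' := by
  refine tensor_ext' fun u t => ?_
  have : f ∘ₗ (tmHom U _).flip t = f' ∘ₗ (tmHom U _).flip t := lin_ext fun a u hu => by
    have : f ∘ₗ tmHom U _ u = f' ∘ₗ tmHom U _ u := tensor_ext fun b c v w hv hw =>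
      h a b c u v w hu hv hw
    exact LinearMap.congr_fun this t
  exact LinearMap.congr_fun this u

theorem tensor_ext_four {U V W X : GradedVec ω} {M : Type*} [AddCommGroup M] [Module ℂ M]
    {f f' : (tensor (tensor (tensor U V) W) X).carrier →ₗ[ℂ] M}
    (h : ∀ a b c d u v w x, U.Homog a u → V.Homog b v → W.Homog c w → X.Homog d x →
      f (tm (tm (tm u v) w) x) = f' (tm (tm (tm u v) w) x)) : f = f' := by
  refine tensor_ext' fun t x => ?_
  have : f ∘ₗ tmHom _ X t = f' ∘ₗ tmHom _ X t := lin_ext fun d x hx => by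
    have : f ∘ₗ (tmHom _ X).flip x = f' ∘ₗ (tmHom _ X).flip x :=
      tensor_ext_left fun a b c u v w hu hv hw => h a b c d u v w x hu hv hw hx
    exact LinearMap.congr_fun this t
  exact LinearMap.congr_fun this x

/-- The linear map underlying the tensor product of two morphisms. -/
def tensorLin {V V' W W' : GradedVec ω} (f : V ⟶ V') (g : W ⟶ W') :
    (tensor V W).carrier →ₗ[ℂ] (tensor V' W').carrier :=
  TensorProduct.map (lin f) (lin g)

theorem tensorLin_apply {V V' W W' : GradedVec ω} (f : V ⟶ V') (g : W ⟶ W') (v : V.carrier)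
    (w : W.carrier) : tensorLin f g (tm v w) = tm (lin f v) (lin g w) := rfl

/-- Tensor product of morphisms. -/
def tensorMap {V V' W W' : GradedVec ω} (f : V ⟶ V') (g : W ⟶ W') :
    tensor V W ⟶ tensor V' W' :=
  Hom.mk (tensorLin f g) fun x => tensor_ext fun a b v w hv hw =>
    comm_at _ (hv.tm hw) (by rw [tensorLin_apply]; exact (hv.map f).tm (hw.map g)) x

theorem tensorMap_apply {V V' W W' : GradedVec ω} (f : V ⟶ V') (g : W ⟶ W') (v : V.carrier)
    (w : W.carrier) : lin (tensorMap f g) (tm v w) = tm (lin f v) (lin g w) := rfl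

/-- The endomorphism of `U ⊗ (V ⊗ W)` multiplying `U_a ⊗ (V_b ⊗ W_c)` by `s a b c`. -/
def scale (s : G → G → G → ℂˣ) (U V W : GradedVec ω) :
    Module.End ℂ (U.carrier ⊗[ℂ] (V.carrier ⊗[ℂ] W.carrier)) :=
  ∑ a : G, ∑ b : G, ∑ c : G, (s a b c : ℂ) •
    TensorProduct.map (U.proj a) (TensorProduct.map (V.proj b) (W.proj c))

theorem scale_apply (s : G → G → G → ℂˣ) {U V W : GradedVec ω} {a b c : G} {u : U.carrier}
    {v : V.carrier} {w : W.carrier} (hu : U.Homog a u) (hv : V.Homog b v) (hw : W.Homog c w) :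
    scale s U V W (u ⊗ₜ[ℂ] (v ⊗ₜ[ℂ] w)) = (s a b c : ℂ) • (u ⊗ₜ[ℂ] (v ⊗ₜ[ℂ] w)) := by
  classical
  unfold scale
  simp only [LinearMap.sum_apply, LinearMap.smul_apply, TensorProduct.map_tmul]
  rw [Finset.sum_eq_single a, Finset.sum_eq_single b, Finset.sum_eq_single c]
  · rw [hu.proj_apply, hv.proj_apply, hw.proj_apply]
    simp
  · intro x _ hx; simp [hw.proj_of_ne hx]
  · simp
  · intro x _ hx; simp [hv.proj_of_ne hx]
  · simp
  · intro x _ hx; simp [hu.proj_of_ne hx]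
  · simp

/-- The linear map underlying the associativity constraint of `Vect_G^ω`:
`(u ⊗ v) ⊗ w ↦ ω(|u|,|v|,|w|) u ⊗ (v ⊗ w)` on homogeneous vectors. -/
def assocLin (U V W : GradedVec ω) :
    (tensor (tensor U V) W).carrier →ₗ[ℂ] (tensor U (tensor V W)).carrier :=
  scale ω U V W ∘ₗ (TensorProduct.assoc ℂ U.carrier V.carrier W.carrier).toLinearMap

/-- The inverse of `assocLin`. -/
def assocInvLin (U V W : GradedVec ω) :
    (tensor U (tensor V W)).carrier →ₗ[ℂ] (tensor (tensor U V) W).carrier :=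
  (TensorProduct.assoc ℂ U.carrier V.carrier W.carrier).symm.toLinearMap ∘ₗ
    scale (fun a b c => (ω a b c)⁻¹) U V W

theorem assocLin_apply {U V W : GradedVec ω} {a b c : G} {u : U.carrier}
    {v : V.carrier} {w : W.carrier} (hu : U.Homog a u) (hv : V.Homog b v) (hw : W.Homog c w) :
    assocLin U V W (tm (tm u v) w) = (ω a b c : ℂ) • tm u (tm v w) :=
  scale_apply ω hu hv hw

theorem assocInvLin_apply {U V W : GradedVec ω} {a b c : G} {u : U.carrier}
    {v : V.carrier} {w : W.carrier} (hu : U.Homog a u) (hv : V.Homog b v) (hw : W.Homog c w) :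
    assocInvLin U V W (tm u (tm v w)) = (((ω a b c)⁻¹ : ℂˣ) : ℂ) • tm (tm u v) w :=
  (congrArg (TensorProduct.assoc ℂ U.carrier V.carrier W.carrier).symm
    (scale_apply (fun a b c => (ω a b c)⁻¹) hu hv hw)).trans
    ((TensorProduct.assoc ℂ U.carrier V.carrier W.carrier).symm.map_smul _ _)

/-- The associativity constraint of `Vect_G^ω`. -/
def associatorIso (U V W : GradedVec ω) : tensor (tensor U V) W ≅ tensor U (tensor V W) where
  hom := Hom.mk (assocLin U V W) fun x => tensor_ext_left fun a b c u v w hu hv hw =>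
    comm_at _ ((hu.tm hv).tm hw) (by
      rw [assocLin_apply hu hv hw, mul_assoc]; exact (hu.tm (hv.tm hw)).smul _) x
  inv := Hom.mk (assocInvLin U V W) fun x => tensor_ext_right fun a b c u v w hu hv hw =>
    comm_at _ (hu.tm (hv.tm hw)) (by
      rw [assocInvLin_apply hu hv hw, ← mul_assoc]; exact ((hu.tm hv).tm hw).smul _) x
  hom_inv_id := hom_ext <| tensor_ext_left fun a b c u v w hu hv hw => by
    change assocInvLin U V W (assocLin U V W _) = tm (tm u v) w
    rw [assocLin_apply hu hv hw, map_smul, assocInvLin_apply hu hv hw, smul_smul,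
      Units.mul_inv, one_smul]
  inv_hom_id := hom_ext <| tensor_ext_right fun a b c u v w hu hv hw => by
    change assocLin U V W (assocInvLin U V W _) = tm u (tm v w)
    rw [assocInvLin_apply hu hv hw, map_smul, assocLin_apply hu hv hw, smul_smul,
      Units.inv_mul, one_smul]

/-- The left unit constraint `c ⊗ v ↦ c v`. -/
def lidLin (V : GradedVec ω) : (tensor (line ω 1) V).carrier ≃ₗ[ℂ] V.carrier :=
  TensorProduct.lid ℂ V.carrier

/-- The map `v ⊗ c ↦ c v`; for `x = 1` the right unit constraint. -/
def ridLin (V : GradedVec ω) (x : G) : (tensor V (line ω x)).carrier ≃ₗ[ℂ] V.carrier :=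
  TensorProduct.rid ℂ V.carrier

theorem lidLin_apply (V : GradedVec ω) (c : ℂ) (v : V.carrier) :
    lidLin V (tm (V := line ω 1) c v) = c • v := rfl

theorem ridLin_apply (V : GradedVec ω) (x : G) (c : ℂ) (v : V.carrier) :
    ridLin V x (tm (W := line ω x) v c) = c • v := rfl

/-- The left unit constraint as an isomorphism. -/
def leftUnitorIso (V : GradedVec ω) : tensor (line ω 1) V ≅ V where
  hom := Hom.mk (lidLin V).toLinearMap fun x => tensor_ext fun a b c w _ hw =>
    comm_at (lidLin V).toLinearMap ((homog_line 1 c).tm hw) (by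
      rw [one_mul]; exact hw.smul c) x
  inv := homOfHomog (lidLin V).symm.toLinearMap fun b w hw => by
    have := (homog_line (ω := ω) 1 (1 : ℂ)).tm hw
    rw [one_mul] at this
    exact this
  hom_inv_id := hom_ext <| LinearMap.ext (lidLin V).symm_apply_apply
  inv_hom_id := hom_ext <| LinearMap.ext (lidLin V).apply_symm_apply

/-- The right unit constraint as an isomorphism. -/
def rightUnitorIso (V : GradedVec ω) : tensor V (line ω 1) ≅ V where
  hom := Hom.mk (ridLin V 1).toLinearMap fun x => tensor_ext fun b a w c hw _ =>
    comm_at (ridLin V 1).toLinearMap (hw.tm (homog_line 1 c)) (by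
      rw [mul_one]; exact hw.smul c) x
  inv := homOfHomog (ridLin V 1).symm.toLinearMap fun b w hw => by
    have := hw.tm (homog_line (ω := ω) 1 (1 : ℂ))
    rw [mul_one] at this
    exact this
  hom_inv_id := hom_ext <| LinearMap.ext (ridLin V 1).symm_apply_apply
  inv_hom_id := hom_ext <| LinearMap.ext (ridLin V 1).apply_symm_apply

instance : MonoidalCategoryStruct (GradedVec ω) where
  tensorObj := tensor
  tensorHom := tensorMap
  whiskerLeft V _ _ f := tensorMap (𝟙 V) f
  whiskerRight f W := tensorMap f (𝟙 W)
  tensorUnit := line ω 1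
  associator := associatorIso
  leftUnitor := leftUnitorIso
  rightUnitor := rightUnitorIso

instance : MonoidalCategory (GradedVec ω) where
  tensorHom_def f g := hom_ext <| tensor_ext' fun v w => rfl
  id_tensorHom_id V W := hom_ext <| tensor_ext' fun v w => rfl
  tensorHom_comp_tensorHom f₁ f₂ g₁ g₂ := hom_ext <| tensor_ext' fun v w => rfl
  whiskerLeft_id V W := hom_ext <| tensor_ext' fun v w => rfl
  id_whiskerRight V W := hom_ext <| tensor_ext' fun v w => rfl
  associator_naturality f₁ f₂ f₃ := hom_ext <| tensor_ext_left fun a b c u v w hu hv hw => by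
    change assocLin _ _ _ (tm (tm (lin f₁ u) (lin f₂ v)) (lin f₃ w)) =
      lin (tensorMap f₁ (tensorMap f₂ f₃)) (assocLin _ _ _ (tm (tm u v) w))
    rw [assocLin_apply hu hv hw, assocLin_apply (hu.map f₁) (hv.map f₂) (hw.map f₃), map_smul,
      tensorMap_apply, tensorMap_apply]
  leftUnitor_naturality f := hom_ext <| tensor_ext' fun c v =>
    (map_smul (lin f) (show ℂ from c) v).symm
  rightUnitor_naturality f := hom_ext <| tensor_ext' fun v c =>
    (map_smul (lin f) (show ℂ from c) v).symm
  pentagon U V W X := hom_ext <| tensor_ext_four fun a b c d u v w x hu hv hw hx => by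
    change lin (tensorMap (𝟙 U) (associatorIso V W X).hom) (assocLin U (tensor V W) X
        (tm (assocLin U V W (tm (tm u v) w)) x)) =
      assocLin U V (tensor W X) (assocLin (tensor U V) W X (tm (tm (tm u v) w) x))
    rw [assocLin_apply hu hv hw, assocLin_apply (hu.tm hv) hw hx, map_smul,
      assocLin_apply hu hv (hw.tm hx), smul_tm, map_smul,
      assocLin_apply hu (hv.tm hw) hx, map_smul, map_smul, tensorMap_apply]
    change _ • _ • tm u (assocLin V W X (tm (tm v w) x)) = _
    rw [assocLin_apply hv hw hx, tm_smul, smul_smul, smul_smul, smul_smul]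
    congr 1
    have := congrArg (Units.val) (ω.cocycle a b c d)
    push_cast at this
    linear_combination this
  triangle V W := hom_ext <| tensor_ext_left fun a b c u v w hu hv hw => by
    change lin (tensorMap (𝟙 V) (leftUnitorIso W).hom) (assocLin V (line ω 1) W _) =
      tm (ridLin V 1 (tm u v)) w
    rw [assocLin_apply hu (homog_line 1 v) hw, ω.normalized _ _ _ (Or.inr (Or.inl rfl)),
      Units.val_one, one_smul, tensorMap_apply]
    change tm u (lidLin W (tm v w)) = _
    refine (tm_smul (V := V) (W := W) v u w).trans (smul_tm (V := V) (W := W) v u w).symm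

instance : Limits.HasZeroMorphisms (GradedVec ω) where
  zero V W := ⟨Hom.mk 0 fun x => by rw [LinearMap.zero_comp, LinearMap.comp_zero]⟩
  comp_zero f X := hom_ext (LinearMap.zero_comp _)
  zero_comp X Y Z f := hom_ext (LinearMap.comp_zero _)

end GradedVec

/-! ### The center of `Vect_G^ω` -/

/-- The right Drinfeld center `Z(Vect_G^ω)`. -/
abbrev ZVec {G : Type u} [Group G] [Fintype G] (ω : ThreeCocycle G) := RightCenter (GradedVec ω)

namespace ZVec

variable {G : Type u} [Group G] [Fintype G] {ω : ThreeCocycle G}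

instance : Limits.HasZeroMorphisms (ZVec ω) where
  zero X Y := ⟨⟨0, fun V => by
    have h1 : V ◁ (0 : X.obj ⟶ Y.obj) = 0 :=
      GradedVec.hom_ext (TensorProduct.map_zero_right _)
    have h2 : (0 : X.obj ⟶ Y.obj) ▷ V = 0 :=
      GradedVec.hom_ext (TensorProduct.map_zero_left _)
    rw [h1, h2, Limits.zero_comp, Limits.comp_zero]⟩⟩
  comp_zero f X := RightCenter.Hom.ext (Limits.comp_zero)
  zero_comp X Y Z f := RightCenter.Hom.ext (Limits.zero_comp)

/-- The action `g ▷ w` of `g ∈ G` on an object of the center, read off from the half-braiding with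
the one-dimensional object `ℂ_g`: `σ (1 ⊗ w) = (g ▷ w) ⊗ 1`. -/
def act (W : ZVec ω) (g : G) : W.obj.carrier →ₗ[ℂ] W.obj.carrier :=
  (GradedVec.ridLin W.obj g).toLinearMap ∘ₗ
    GradedVec.lin (W.hb.σ (GradedVec.line ω g)).hom ∘ₗ
    GradedVec.tmHom (GradedVec.line ω g) W.obj (GradedVec.lineOne ω g)

/-- `W` is the simple object of `Z(Vect_G^ω)` parametrized by `(g, χ)`: it is simple, its component
`W_g` is nonzero, and `χ` is the character of the projective representation of the centralizer
`C_G(g)` on `W_g`.  (For `c ∈ C_G(g)`, the composite `act c ∘ proj g` is the action of `c` on `W_g`,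
extended by zero to the other components.)  Only the values of `χ` on `C_G(g)` matter. -/
def IsSimpleWith (W : ZVec ω) (g : G) (χ : G → ℂ) : Prop :=
  Simple W ∧ W.obj.proj g ≠ 0 ∧
    ∀ c ∈ Subgroup.centralizer {g}, χ c = LinearMap.trace ℂ _ (act W c ∘ₗ W.obj.proj g)

/-- The Borromean tensor: the pivotal trace of the Borromean braid on `(U ⊗ V) ⊗ W`.  For the
canonical pivotal structure, for which categorical dimensions are vector space dimensions, the
pivotal trace is the trace of the underlying linear map. -/
def borromeanTensor (U V W : ZVec ω) : ℂ :=
  LinearMap.trace ℂ _ (GradedVec.lin (RightCenter.borromeanBraid U V W))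

end ZVec

/-! ### The ingredients of the formula -/

/-- Conjugation `g ▷ h = g h g⁻¹` in a group. -/
def hit {G : Type u} [Group G] (g h : G) : G := g * h * g⁻¹

namespace ThreeCocycle

variable {G : Type u} [Group G] (ω : ThreeCocycle G)

/-- `α_g(x, y) = ω(x, y, g)⁻¹ ω(x, y ▷ g, y) ω(xy ▷ g, x, y)⁻¹`, the scalar for which the
half-braidings give `x ▷ (y ▷ w) = α_{|w|}(x, y) (xy) ▷ w` on objects of the center. -/
def alpha (g x y : G) : ℂˣ :=
  (ω x y g)⁻¹ * ω x (hit y g) y * (ω (hit (x * y) g) x y)⁻¹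

/-- `ψ(x, x', y, z) = ω(y, z, x')⁻¹ ω(y, x, z) α_x(z, z⁻¹)⁻¹`: for `u, v, w` of degrees `x, y', z`
and `y = x ▷ y'`, `x' = z⁻¹ ▷ x`, the scalar with which `σ₂⁻¹σ₁` maps `(u ⊗ v) ⊗ w` to
`((x ▷ v) ⊗ w) ⊗ (z⁻¹ ▷ u)`. -/
def psi (x x' y z : G) : ℂˣ := (ω y z x')⁻¹ * ω y x z * (ω.alpha x z z⁻¹)⁻¹

/-- The cocycle factor `Ω(x, y, z)`: one factor `ψ` for each of the three steps `σ₂⁻¹σ₁`, and one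
factor `α` for each of the three strands, from combining its two successive actions into one. -/
def Omega (x y z : G) : ℂˣ :=
  ω.psi x (hit z⁻¹ x) (hit x y) z *
    ω.psi (hit x y) y (hit y z) (hit z⁻¹ x) *
    ω.psi (hit y z) z x y *
    (ω.alpha y (hit z⁻¹ x)⁻¹ x * ω.alpha x (hit y z) z⁻¹ * ω.alpha z y⁻¹ (hit x y))

/-- The conjugated projective character
`(p ▷ χ)(c) = α_g(c, p) α_g(p, p⁻¹ ▷ c)⁻¹ χ(p⁻¹ ▷ c)`, for `χ` an `α_g`-projective character. -/
def conjChar (g p : G) (χ : G → ℂ) (c : G) : ℂ :=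
  (ω.alpha g c p : ℂ) * ((ω.alpha g p (hit p⁻¹ c))⁻¹ : ℂˣ) * χ (hit p⁻¹ c)

end ThreeCocycle

end

/-!
The Borromean tensor is the trace of a map that permutes the homogeneous components
`(U_a ⊗ V_b) ⊗ W_c`, so it is the sum over `(a, b, c)` of the traces of the diagonal blocks
(`ZVec.borromeanTensor_eq_sum`).

*One block.* On homogeneous vectors every half-braiding is `v ⊗ w ↦ (|v| ▷ w) ⊗ v`
(`ZVec.sig_apply`), hence the step `σ₂⁻¹σ₁` is multiplication by a scalar `ψ` followed by one action
on each of two strands (`ZVec.braidStep_apply`). After three steps each strand has been acted on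
twice; combining the two actions costs a factor `α`. The resulting map is a scalar times a pure
tensor of three maps, so its trace is a product of three traces (`ZVec.localTensor_eq`). The factor
of a strand vanishes unless the strand returns to its degree; the three conditions that all strands
return reduce to the two commutator conditions by a form of the Hall–Witt identity
(`commutator_conditions_iff`).

*Invariance.* An element `s` acts diagonally on the triple tensor product, through the scalars
`γ_s`. The braids are morphisms of the center and therefore commute with this action: for the
braidings this is an identity between `γ` and `α`, for the associativity constraints it is a
combination of four instances of the cocycle identity (`ThreeCocycle.gamma_assoc`). Since `s`
carries the block of `(a, b, c)` to the block of the conjugated degrees, the traces of the two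
blocks agree (`ZVec.localTensor_hit`).

*Simple objects.* The projection onto the components with degrees in a conjugacy class is an
idempotent of the center. It splits there, so the degrees of a simple object form one conjugacy
class (`ZVec.isConj_of_proj_ne_zero`), and transport along `p ▷` turns the character on `W_g` into
`p ▷ χ` on `W_{p ▷ g}` (`ZVec.conjChar_eq_actTrace`). A sum over the three classes is then a sum
over three conjugators with factor `|class| / |G|` each, and by invariance the third conjugator may
be fixed to be `1`, which gains one factor `|G|`.
-/

/-! ### The action of the group on an object of the center -/

namespace GradedVec

variable {G : Type u} [Group G] [Fintype G] {ω : ThreeCocycle G}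

/-- The morphism `ℂ_x ⟶ V` sending `1` to a vector `v` of degree `x`. -/
noncomputable def lineHom {V : GradedVec ω} {x : G} {v : V.carrier} (hv : V.Homog x v) :
    line ω x ⟶ V :=
  homOfHomog (LinearMap.toSpanSingleton ℂ V.carrier v) fun y c hc => by
    classical
    have h : (line ω x).proj y c = if y = x then c else 0 := (homog_line x c).proj_apply y
    rw [hc] at h
    split_ifs at h with e
    · subst e
      exact hv.smul c
    · rw [h]
      change V.proj y (LinearMap.toSpanSingleton ℂ V.carrier v (0 : ℂ)) =
        LinearMap.toSpanSingleton ℂ V.carrier v (0 : ℂ)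
      simp

theorem lineHom_one {V : GradedVec ω} {x : G} {v : V.carrier} (hv : V.Homog x v) :
    lin (lineHom hv) (lineOne ω x) = v := one_smul ℂ v

theorem ridLin_proj (V : GradedVec ω) (x b : G) (t : (tensor V (line ω x)).carrier) :
    ridLin V x ((tensor V (line ω x)).proj b t) = V.proj (b * x⁻¹) (ridLin V x t) := by
  classical
  have h : (ridLin V x).toLinearMap ∘ₗ (tensor V (line ω x)).proj b =
      V.proj (b * x⁻¹) ∘ₗ (ridLin V x).toLinearMap :=
    tensor_ext fun a y v c hv _ => by
      have hc := homog_line (ω := ω) x c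
      have e0 : ridLin V x (tm v c) = (show ℂ from c) • v := rfl
      change ridLin V x _ = V.proj (b * x⁻¹) (ridLin V x (tm v c))
      rw [(hv.tm hc).proj_apply, e0, (hv.smul (show ℂ from c)).proj_apply]
      by_cases e : b = a * x
      · subst e
        rw [if_pos rfl, if_pos (mul_inv_cancel_right a x)]
        rfl
      · rw [if_neg e, if_neg (fun e' => e (by rw [← e', inv_mul_cancel_right])), map_zero]
  exact LinearMap.congr_fun h t

end GradedVec

namespace ZVec

open GradedVec

variable {G : Type u} [Group G] [Fintype G] {ω : ThreeCocycle G}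

/-- The linear map underlying the half-braiding of `W` at `V`. -/
noncomputable def sig (V : GradedVec ω) (W : ZVec ω) :
    (tensor V W.obj).carrier →ₗ[ℂ] (tensor W.obj V).carrier :=
  lin (W.hb.σ V).hom

/-- The linear map underlying the inverse of the half-braiding of `W` at `V`. -/
noncomputable def sigInv (V : GradedVec ω) (W : ZVec ω) :
    (tensor W.obj V).carrier →ₗ[ℂ] (tensor V W.obj).carrier :=
  lin (W.hb.σ V).inv

theorem sigInv_sig (V : GradedVec ω) (W : ZVec ω) (t : (tensor V W.obj).carrier) :
    sigInv V W (sig V W t) = t :=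
  LinearMap.congr_fun (congrArg lin (W.hb.σ V).hom_inv_id) t

theorem sig_sigInv (V : GradedVec ω) (W : ZVec ω) (t : (tensor W.obj V).carrier) :
    sig V W (sigInv V W t) = t :=
  LinearMap.congr_fun (congrArg lin (W.hb.σ V).inv_hom_id) t

theorem sig_line (W : ZVec ω) (x : G) (w : W.obj.carrier) :
    sig (line ω x) W (tm (lineOne ω x) w) = tm (act W x w) (lineOne ω x) :=
  ((ridLin W.obj x).symm_apply_apply _).symm

/-- On a vector `v` of degree `x` the half-braiding is `v ⊗ w ↦ (x ▷ w) ⊗ v`. -/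
theorem sig_apply {V : GradedVec ω} (W : ZVec ω) {x : G} {v : V.carrier} (hv : V.Homog x v)
    (w : W.obj.carrier) : sig V W (tm v w) = tm (act W x w) v := by
  have h := LinearMap.congr_fun (congrArg lin (W.hb.naturality (lineHom hv)))
    (tm (lineOne ω x) w)
  have h1 : lin ((lineHom hv ▷ W.obj) ≫ (W.hb.σ V).hom) (tm (lineOne ω x) w) =
      sig V W (tm (lin (lineHom hv) (lineOne ω x)) w) := rfl
  have h2 : lin ((W.hb.σ (line ω x)).hom ≫ (W.obj ◁ lineHom hv)) (tm (lineOne ω x) w) =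
      lin (tensorMap (𝟙 W.obj) (lineHom hv)) (sig (line ω x) W (tm (lineOne ω x) w)) := rfl
  rw [h1, h2, sig_line, tensorMap_apply, lineHom_one hv] at h
  exact h

/-- Injectivity comes from the half-braiding being invertible, before the unit element is known to
act as the identity. -/
theorem act_injective (W : ZVec ω) (x : G) : Function.Injective (act W x) := by
  refine (ridLin W.obj x).injective.comp (Function.Injective.comp
    (g := sig (line ω x) W) (Function.LeftInverse.injective (sigInv_sig _ W)) ?_)
  exact (TensorProduct.lid ℂ W.obj.carrier).symm.injective

/-- The element `x` maps the component `W_a` into `W_{x ▷ a}`. -/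
theorem homog_act (W : ZVec ω) (x : G) {a : G} {w : W.obj.carrier} (hw : W.obj.Homog a w) :
    W.obj.Homog (hit x a) (act W x w) := by
  have h := ((homog_line (ω := ω) x (lineOne ω x)).tm hw).map (W.hb.σ (line ω x)).hom
  have h2 := congrArg (ridLin W.obj x) h
  exact (ridLin_proj W.obj x (x * a) _).symm.trans h2

/-- The composition law of the actions, read off from the half-braiding with `ℂ_x ⊗ ℂ_y`. -/
theorem act_act (W : ZVec ω) (x y : G) {a : G} {w : W.obj.carrier} (hw : W.obj.Homog a w) :
    act W x (act W y w) = (ω.alpha a x y : ℂ) • act W (x * y) w := by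
  have hx := homog_line x (lineOne ω x)
  have hy := homog_line y (lineOne ω y)
  have h := LinearMap.congr_fun (congrArg lin (W.hb.monoidal (line ω x) (line ω y)))
    (tm (tm (lineOne ω x) (lineOne ω y)) w)
  change sig (tensor (line ω x) (line ω y)) W _ =
    assocLin _ _ _ (tensorLin (W.hb.σ (line ω x)).hom (𝟙 _) (assocInvLin _ _ _
      (tensorLin (𝟙 _) (W.hb.σ (line ω y)).hom (assocLin _ _ _
        (tm (tm (lineOne ω x) (lineOne ω y)) w))))) at h
  rw [sig_apply W (hx.tm hy), assocLin_apply hx hy hw, map_smul, tensorLin_apply] at h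
  change _ = assocLin _ _ _ (tensorLin _ _ (assocInvLin _ _ _
    (_ • tm (lineOne ω x) (sig _ W (tm (lineOne ω y) w))))) at h
  rw [sig_apply W hy, map_smul, assocInvLin_apply hx (homog_act W y hw) hy, smul_smul, map_smul,
    tensorLin_apply] at h
  change _ = assocLin _ _ _ (_ • tm (sig _ W (tm (lineOne ω x) _)) (lineOne ω y)) at h
  rw [sig_apply W hx, map_smul, assocLin_apply (homog_act W x (homog_act W y hw)) hx hy,
    smul_smul] at h
  have e : Function.Injective (fun v : W.obj.carrier =>
      tm v (tm (lineOne ω x) (lineOne ω y))) := by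
    intro v v' e
    have := congrArg ((ridLin W.obj x) ∘ (ridLin (tensor W.obj (line ω x)) y) ∘
      (TensorProduct.assoc ℂ W.obj.carrier ℂ ℂ).symm) e
    change (1 : ℂ) • (1 : ℂ) • v = (1 : ℂ) • (1 : ℂ) • v' at this
    simpa using this
  rw [← smul_tm] at h
  have h := e h
  rw [h, smul_smul]
  have hh : hit x (hit y a) = hit (x * y) a := by simp [hit, mul_assoc]
  rw [hh]
  have hα : (ω.alpha a x y : ℂ) * ((ω x y a : ℂ) * (((ω x (hit y a) y)⁻¹ : ℂˣ) : ℂ) *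
      (ω (hit (x * y) a) x y : ℂ)) = 1 := by
    simp only [ThreeCocycle.alpha]
    push_cast
    field_simp
  rw [hα, one_smul]

theorem act_one (W : ZVec ω) (w : W.obj.carrier) : act W 1 w = w := by
  -- Normalization gives `1 ▷ (1 ▷ w) = 1 ▷ w`, and one copy of `1 ▷` can be cancelled.
  have h : act W 1 = LinearMap.id := lin_ext fun a w hw => act_injective W 1 (by
    rw [act_act W 1 1 hw, LinearMap.id_apply, mul_one]
    simp [ThreeCocycle.alpha, ω.normalized])
  exact LinearMap.congr_fun h w

theorem act_inv_act (W : ZVec ω) (x : G) {a : G} {w : W.obj.carrier} (hw : W.obj.Homog a w) :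
    act W x (act W x⁻¹ w) = (ω.alpha a x x⁻¹ : ℂ) • w := by
  rw [act_act W x x⁻¹ hw, mul_inv_cancel, act_one]

theorem sigInv_apply {V : GradedVec ω} (W : ZVec ω) {x a : G} {v : V.carrier}
    {w : W.obj.carrier} (hv : V.Homog x v) (hw : W.obj.Homog a w) :
    sigInv V W (tm w v) = (((ω.alpha a x x⁻¹)⁻¹ : ℂˣ) : ℂ) • tm v (act W x⁻¹ w) := by
  have h := sig_apply W hv (act W x⁻¹ w)
  rw [act_inv_act W x hw, smul_tm] at h
  rw [← sigInv_sig V W (tm v (act W x⁻¹ w)), h, map_smul, smul_smul, Units.inv_mul, one_smul]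

/-- The step `σ₂⁻¹σ₁` on homogeneous vectors. -/
theorem braidStep_apply (U V W : ZVec ω) {x y z : G} {u : U.obj.carrier} {v : V.obj.carrier}
    {w : W.obj.carrier} (hu : U.obj.Homog x u) (hv : V.obj.Homog y v) (hw : W.obj.Homog z w) :
    lin (RightCenter.braidStep U V W) (tm (tm u v) w) =
      (ω.psi x (hit z⁻¹ x) (hit x y) z : ℂ) • tm (tm (act V x v) w) (act U z⁻¹ u) := by
  have hv' := homog_act V x hv
  have hu' := homog_act U z⁻¹ hu
  change assocInvLin _ _ _ (tensorLin (𝟙 _) (U.hb.σ W.obj).inv (assocLin _ _ _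
    (tm (sig U.obj V (tm u v)) w))) = _
  rw [sig_apply V hu, assocLin_apply hv' hu hw, map_smul, tensorLin_apply]
  change assocInvLin _ _ _ (_ • tm (act V x v) (sigInv W.obj U (tm u w))) = _
  rw [sigInv_apply U hw hu, tm_smul, map_smul, map_smul, assocInvLin_apply hv' hw hu', smul_smul,
    smul_smul, ThreeCocycle.psi]
  congr 1
  push_cast
  ring

end ZVec

/-! ### Equivariance of the braids under simultaneous conjugation -/

namespace ThreeCocycle

variable {G : Type u} [Group G] (ω : ThreeCocycle G)

/-- The scalar `γ_s(x, y)` with which `s` acts diagonally on tensor products in the center: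
`s ▷ (u ⊗ v) = γ_s(x, y) (s ▷ u) ⊗ (s ▷ v)` for `u`, `v` of degrees `x`, `y`. -/
noncomputable def gamma (s x y : G) : ℂˣ :=
  ω (hit s x) s y * (ω s x y)⁻¹ * (ω (hit s x) (hit s y) s)⁻¹

/-- The braiding commutes with the diagonal actions; no cocycle identity is needed, all factors
cancel in pairs. -/
theorem gamma_mul_alpha (s x y : G) :
    ω.gamma s (hit x y) x * ω.alpha y s x = ω.gamma s x y * ω.alpha y (hit s x) s := by
  have h1 : hit s (hit x y) = hit (s * x) y := by simp [hit, mul_assoc]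
  have h2 : hit s x * s = s * x := by simp [hit]
  ext
  simp only [gamma, alpha, h1, h2]
  push_cast
  field_simp

/-- The associativity constraint commutes with the diagonal actions. -/
theorem gamma_assoc (s x y z : G) :
    ω (hit s x) (hit s y) (hit s z) * (ω.gamma s (x * y) z * ω.gamma s x y) =
      ω x y z * (ω.gamma s x (y * z) * ω.gamma s y z) := by
  have h1 : ∀ a, hit s a * s = s * a := fun a => by simp [hit]
  have h2 : hit s (x * y) = hit s x * hit s y := by simp [hit]
  have h3 : hit s (y * z) = hit s y * hit s z := by simp [hit]
  -- The four ways to insert `s` into the triple, moving it from the left to the right.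
  have c1 := ω.cocycle s x y z
  have c2 := ω.cocycle (hit s x) s y z
  have c3 := ω.cocycle (hit s x) (hit s y) s z
  have c4 := ω.cocycle (hit s x) (hit s y) (hit s z) s
  simp only [gamma, h1, h2, h3] at *
  have e1 := congrArg Additive.ofMul c1
  have e2 := congrArg Additive.ofMul c2
  have e3 := congrArg Additive.ofMul c3
  have e4 := congrArg Additive.ofMul c4
  apply Additive.ofMul.injective
  simp only [ofMul_mul, ofMul_inv] at *
  linear_combination (norm := abel) e2 - e1 - e3 + e4

end ThreeCocycle

namespace GradedVec

variable {G : Type u} [Group G] [Fintype G] {ω : ThreeCocycle G}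

theorem Homog.proj {V : GradedVec ω} {a : G} {v : V.carrier} (hv : V.Homog a v) (b : G) :
    V.Homog a (V.proj b v) := by
  classical
  rw [hv.proj_apply]
  split_ifs
  · exact hv
  · exact map_zero _

/-- The endomorphism of `V ⊗ W` multiplying `V_a ⊗ W_b` by `r a b`. -/
noncomputable def scale₂ (r : G → G → ℂˣ) (V W : GradedVec ω) :
    Module.End ℂ (tensor V W).carrier :=
  ∑ a : G, ∑ b : G, (r a b : ℂ) • TensorProduct.map (V.proj a) (W.proj b)

theorem scale₂_apply (r : G → G → ℂˣ) {V W : GradedVec ω} {a b : G} {v : V.carrier}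
    {w : W.carrier} (hv : V.Homog a v) (hw : W.Homog b w) :
    scale₂ r V W (tm v w) = (r a b : ℂ) • tm v w := by
  classical
  change (∑ a : G, ∑ b : G, (r a b : ℂ) • TensorProduct.map (V.proj a) (W.proj b))
    (v ⊗ₜ[ℂ] w) = (r a b : ℂ) • (v ⊗ₜ[ℂ] w)
  simp only [LinearMap.sum_apply, LinearMap.smul_apply, TensorProduct.map_tmul]
  rw [Finset.sum_eq_single a, Finset.sum_eq_single b]
  · rw [hv.proj_apply, hw.proj_apply]
    simp
  · intro x _ hx; simp [hw.proj_of_ne hx]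
  · simp
  · intro x _ hx; simp [hv.proj_of_ne hx]
  · simp

theorem scale₂_bijective (r : G → G → ℂˣ) (V W : GradedVec ω) :
    Function.Bijective (scale₂ r V W) := by
  have h : scale₂ r⁻¹ V W ∘ₗ scale₂ r V W = LinearMap.id :=
    tensor_ext fun a b v w hv hw => by
      rw [LinearMap.comp_apply, scale₂_apply r hv hw, map_smul, scale₂_apply _ hv hw, smul_smul,
        Pi.inv_apply, Pi.inv_apply, Units.mul_inv, one_smul, LinearMap.id_apply]
  have hinj : Function.Injective (scale₂ r V W) :=
    Function.LeftInverse.injective (LinearMap.congr_fun h)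
  have : FiniteDimensional ℂ (tensor V W).carrier := (tensor V W).finiteDimensional
  exact ⟨hinj, LinearMap.injective_iff_surjective.mp hinj⟩

/-- The diagonal action of `s` on `V ⊗ W`, for linear maps `f`, `g` by which `s` acts on
`V` and `W`: `v ⊗ w ↦ γ_s(|v|, |w|) f v ⊗ g w`. -/
noncomputable def diag (s : G) {V W : GradedVec ω} (f : Module.End ℂ V.carrier)
    (g : Module.End ℂ W.carrier) : Module.End ℂ (tensor V W).carrier :=
  (TensorProduct.map f g : (tensor V W).carrier →ₗ[ℂ] (tensor V W).carrier) ∘ₗ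
    scale₂ (ω.gamma s) V W

theorem diag_apply (s : G) {V W : GradedVec ω} (f : Module.End ℂ V.carrier)
    (g : Module.End ℂ W.carrier) {a b : G} {v : V.carrier} {w : W.carrier}
    (hv : V.Homog a v) (hw : W.Homog b w) :
    diag s f g (tm v w) = (ω.gamma s a b : ℂ) • tm (f v) (g w) :=
  (congrArg (TensorProduct.map f g) (scale₂_apply (ω.gamma s) hv hw)).trans
    (map_smul (TensorProduct.map f g) _ _)

theorem diag_bijective (s : G) {V W : GradedVec ω} {f : Module.End ℂ V.carrier}
    {g : Module.End ℂ W.carrier} (hf : Function.Bijective f) (hg : Function.Bijective g) :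
    Function.Bijective (diag s f g) :=
  (TensorProduct.congr (LinearEquiv.ofBijective f hf)
    (LinearEquiv.ofBijective g hg)).bijective.comp (scale₂_bijective (ω.gamma s) V W)

theorem diag_naturality (s : G) {V W V' W' : GradedVec ω} {f : Module.End ℂ V.carrier}
    {g : Module.End ℂ W.carrier} {f' : Module.End ℂ V'.carrier} {g' : Module.End ℂ W'.carrier}
    (φ : V ⟶ V') (θ : W ⟶ W') (hφ : ∀ v, lin φ (f v) = f' (lin φ v))
    (hθ : ∀ w, lin θ (g w) = g' (lin θ w)) (t : (tensor V W).carrier) :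
    lin (tensorMap φ θ) (diag s f g t) = diag s f' g' (lin (tensorMap φ θ) t) := by
  have h : lin (tensorMap φ θ) ∘ₗ diag s f g = diag s f' g' ∘ₗ lin (tensorMap φ θ) :=
    tensor_ext fun a b v w hv hw => by
      rw [LinearMap.comp_apply, LinearMap.comp_apply, diag_apply s f g hv hw, map_smul,
        tensorMap_apply, tensorMap_apply, diag_apply s f' g' (hv.map φ) (hw.map θ), hφ, hθ]
  exact LinearMap.congr_fun h t

/-- The tensor product of three linear maps, as an endomorphism of `(U ⊗ V) ⊗ W`. -/
noncomputable def map₃ {U V W : GradedVec ω} (e : Module.End ℂ U.carrier)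
    (f : Module.End ℂ V.carrier) (g : Module.End ℂ W.carrier) :
    Module.End ℂ (tensor (tensor U V) W).carrier :=
  TensorProduct.map (TensorProduct.map e f) g

theorem trace_map₃ {U V W : GradedVec ω} (e : Module.End ℂ U.carrier)
    (f : Module.End ℂ V.carrier) (g : Module.End ℂ W.carrier) :
    LinearMap.trace ℂ _ (map₃ e f g) =
      LinearMap.trace ℂ _ e * LinearMap.trace ℂ _ f * LinearMap.trace ℂ _ g :=
  (LinearMap.trace_tensorProduct' _ _).trans
    (congrArg (· * _) (LinearMap.trace_tensorProduct' _ _))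

theorem assoc_diag (s : G) {U V W : GradedVec ω} (e : Module.End ℂ U.carrier)
    (f : Module.End ℂ V.carrier) (g : Module.End ℂ W.carrier)
    (he : ∀ a v, U.Homog a v → U.Homog (hit s a) (e v))
    (hf : ∀ a v, V.Homog a v → V.Homog (hit s a) (f v))
    (hg : ∀ a w, W.Homog a w → W.Homog (hit s a) (g w))
    (t : (tensor (tensor U V) W).carrier) :
    assocLin U V W (diag s (diag s e f) g t) = diag s e (diag s f g) (assocLin U V W t) := by
  have h : assocLin U V W ∘ₗ diag s (diag s e f) g =
      diag s e (diag s f g) ∘ₗ assocLin U V W :=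
    tensor_ext_left fun a b c u v w hu hv hw => by
      rw [LinearMap.comp_apply, LinearMap.comp_apply, diag_apply s _ _ (hu.tm hv) hw,
        diag_apply s _ _ hu hv, assocLin_apply hu hv hw, map_smul, map_smul,
        diag_apply s _ _ hu (hv.tm hw), diag_apply s _ _ hv hw, smul_tm, tm_smul, map_smul,
        assocLin_apply (he a u hu) (hf b v hv) (hg c w hw), smul_smul, smul_smul, smul_smul,
        smul_smul]
      congr 1
      have := congrArg Units.val (ω.gamma_assoc s a b c)
      push_cast at this
      linear_combination this
  exact LinearMap.congr_fun h t

end GradedVec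

namespace ZVec

open GradedVec

variable {G : Type u} [Group G] [Fintype G] {ω : ThreeCocycle G}

theorem act_bijective (W : ZVec ω) (x : G) : Function.Bijective (act W x) :=
  ⟨act_injective W x, LinearMap.injective_iff_surjective.mp (act_injective W x)⟩

/-- The braidings are equivariant for the diagonal actions. -/
theorem sig_diag (s : G) (U V : ZVec ω) (t : (tensor U.obj V.obj).carrier) :
    sig U.obj V (diag s (act U s) (act V s) t) = diag s (act V s) (act U s) (sig U.obj V t) := by
  have h : sig U.obj V ∘ₗ diag s (act U s) (act V s) =
      diag s (act V s) (act U s) ∘ₗ sig U.obj V :=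
    tensor_ext fun a b u v hu hv => by
      have hs : hit s a * s = s * a := by simp [hit]
      rw [LinearMap.comp_apply, LinearMap.comp_apply, diag_apply s _ _ hu hv, map_smul,
        sig_apply V (homog_act U s hu), sig_apply V hu, diag_apply s _ _ (homog_act V a hv) hu,
        act_act V _ _ hv, act_act V _ _ hv, hs, smul_tm, smul_tm, smul_smul, smul_smul]
      congr 1
      exact_mod_cast (ω.gamma_mul_alpha s a b).symm
  exact LinearMap.congr_fun h t

theorem sigInv_diag (s : G) (U V : ZVec ω) (t : (tensor V.obj U.obj).carrier) :
    sigInv U.obj V (diag s (act V s) (act U s) t) =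
      diag s (act U s) (act V s) (sigInv U.obj V t) := by
  conv_lhs => rw [← sig_sigInv U.obj V t, ← sig_diag, sigInv_sig]

/-- The diagonal action of `s` on `(U ⊗ V) ⊗ W`. -/
noncomputable def diag₃ (s : G) (U V W : ZVec ω) :
    Module.End ℂ (tensor (tensor U.obj V.obj) W.obj).carrier :=
  diag s (diag s (act U s) (act V s)) (act W s)

theorem diag₃_bijective (s : G) (U V W : ZVec ω) : Function.Bijective (diag₃ s U V W) :=
  diag_bijective s (diag_bijective s (act_bijective U s) (act_bijective V s)) (act_bijective W s)

theorem assocInv_diag (s : G) (U V W : ZVec ω)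
    (t : (tensor U.obj (tensor V.obj W.obj)).carrier) :
    assocInvLin _ _ _ (diag s (act U s) (diag s (act V s) (act W s)) t) =
      diag₃ s U V W (assocInvLin _ _ _ t) := by
  have h1 : ∀ t, assocLin U.obj V.obj W.obj (assocInvLin _ _ _ t) = t :=
    LinearMap.congr_fun (congrArg lin (associatorIso U.obj V.obj W.obj).inv_hom_id)
  have h2 : ∀ t, assocInvLin U.obj V.obj W.obj (assocLin _ _ _ t) = t :=
    LinearMap.congr_fun (congrArg lin (associatorIso U.obj V.obj W.obj).hom_inv_id)
  conv_lhs => rw [← h1 t, ← assoc_diag s _ _ _ (fun a v => homog_act U s)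
    (fun a v => homog_act V s) (fun a v => homog_act W s), h2]
  rfl

theorem braidStep_diag₃ (s : G) (U V W : ZVec ω)
    (t : (tensor (tensor U.obj V.obj) W.obj).carrier) :
    lin (RightCenter.braidStep U V W) (diag₃ s U V W t) =
      diag₃ s V W U (lin (RightCenter.braidStep U V W) t) := by
  change assocInvLin _ _ _ (lin (tensorMap (𝟙 _) (U.hb.σ W.obj).inv) (assocLin _ _ _
    (lin (tensorMap (V.hb.σ U.obj).hom (𝟙 _)) (diag₃ s U V W t)))) =
    diag₃ s V W U (assocInvLin _ _ _ (lin (tensorMap (𝟙 _) (U.hb.σ W.obj).inv) (assocLin _ _ _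
    (lin (tensorMap (V.hb.σ U.obj).hom (𝟙 _)) t))))
  rw [← assocInv_diag, diag₃, diag_naturality s (f' := diag s (act V s) (act U s))
      (g' := act W s) _ _ (sig_diag s U V) (fun _ => rfl),
    assoc_diag s _ _ _ (fun a v => homog_act V s) (fun a v => homog_act U s)
      (fun a v => homog_act W s),
    diag_naturality s (f' := act V s) (g' := diag s (act W s) (act U s)) _ _ (fun _ => rfl)
      (sigInv_diag s W U)]

/-- The linear map underlying the Borromean braid. -/
noncomputable def borromeanLin (U V W : ZVec ω) :
    Module.End ℂ (tensor (tensor U.obj V.obj) W.obj).carrier :=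
  lin (RightCenter.borromeanBraid U V W)

theorem borromeanLin_apply (U V W : ZVec ω) (t : (tensor (tensor U.obj V.obj) W.obj).carrier) :
    borromeanLin U V W t = lin (RightCenter.braidStep W U V)
      (lin (RightCenter.braidStep V W U) (lin (RightCenter.braidStep U V W) t)) := rfl

theorem borromeanLin_diag₃ (s : G) (U V W : ZVec ω)
    (t : (tensor (tensor U.obj V.obj) W.obj).carrier) :
    borromeanLin U V W (diag₃ s U V W t) = diag₃ s U V W (borromeanLin U V W t) := by
  rw [borromeanLin_apply, braidStep_diag₃, braidStep_diag₃, braidStep_diag₃]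
  rfl

/-- The projection of `(U ⊗ V) ⊗ W` onto `(U_a ⊗ V_b) ⊗ W_c`. -/
noncomputable def proj₃ (U V W : ZVec ω) (a b c : G) :
    Module.End ℂ (tensor (tensor U.obj V.obj) W.obj).carrier :=
  map₃ (U.obj.proj a) (V.obj.proj b) (W.obj.proj c)

theorem proj₃_apply (U V W : ZVec ω) (a b c : G) (u : U.obj.carrier) (v : V.obj.carrier)
    (w : W.obj.carrier) : proj₃ U V W a b c (tm (tm u v) w) =
      tm (tm (U.obj.proj a u) (V.obj.proj b v)) (W.obj.proj c w) := rfl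

/-- The contribution of the component `(U_a ⊗ V_b) ⊗ W_c` to the Borromean tensor. -/
noncomputable def localTensor (U V W : ZVec ω) (a b c : G) : ℂ :=
  LinearMap.trace ℂ _ (borromeanLin U V W ∘ₗ proj₃ U V W a b c)

theorem proj_act (W : ZVec ω) (s a : G) (w : W.obj.carrier) :
    W.obj.proj (hit s a) (act W s w) = act W s (W.obj.proj a w) := by
  classical
  have h : W.obj.proj (hit s a) ∘ₗ act W s = act W s ∘ₗ W.obj.proj a := lin_ext fun b w hw => by
    rw [LinearMap.comp_apply, LinearMap.comp_apply, (homog_act W s hw).proj_apply, hw.proj_apply]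
    have : hit s a = hit s b ↔ a = b := by simp [hit]
    by_cases e : a = b
    · rw [if_pos e, if_pos (this.2 e)]
    · rw [if_neg e, if_neg (fun e' => e (this.1 e')), map_zero]
  exact LinearMap.congr_fun h w

theorem proj₃_diag₃ (s : G) (U V W : ZVec ω) (a b c : G) :
    proj₃ U V W (hit s a) (hit s b) (hit s c) ∘ₗ diag₃ s U V W =
      diag₃ s U V W ∘ₗ proj₃ U V W a b c := by
  refine tensor_ext_left fun x y z u v w hu hv hw => ?_
  have key : ∀ u v w, U.obj.Homog x u → V.obj.Homog y v → W.obj.Homog z w →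
      diag₃ s U V W (tm (tm u v) w) = ((ω.gamma s (x * y) z : ℂ) * ω.gamma s x y) •
        tm (tm (act U s u) (act V s v)) (act W s w) := fun u v w hu hv hw => by
    rw [diag₃, diag_apply s _ _ (hu.tm hv) hw, diag_apply s _ _ hu hv, smul_tm, smul_smul]
  rw [LinearMap.comp_apply, LinearMap.comp_apply, key u v w hu hv hw, map_smul, proj₃_apply,
    proj₃_apply, key _ _ _ (hu.proj a) (hv.proj b) (hw.proj c), proj_act, proj_act, proj_act]

/-- Simultaneous conjugation of the degrees does not change the contribution to the Borromean
tensor. -/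
theorem localTensor_hit (s : G) (U V W : ZVec ω) (a b c : G) :
    localTensor U V W (hit s a) (hit s b) (hit s c) = localTensor U V W a b c := by
  let D := LinearEquiv.ofBijective _ (diag₃_bijective s U V W)
  unfold localTensor
  rw [← LinearMap.trace_conj' (borromeanLin U V W ∘ₗ proj₃ U V W a b c) D]
  congr 1
  refine LinearMap.ext fun t => ?_
  obtain ⟨t, rfl⟩ := D.surjective t
  rw [LinearEquiv.conj_apply_apply, D.symm_apply_apply]
  change borromeanLin U V W (proj₃ U V W _ _ _ (diag₃ s U V W t)) = diag₃ s U V W _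
  rw [LinearMap.comp_apply, ← borromeanLin_diag₃]
  exact congrArg _ (LinearMap.congr_fun (proj₃_diag₃ s U V W a b c) t)

end ZVec

/-! ### The trace of the Borromean braid on homogeneous components -/

section Conjugation

variable {G : Type u} [Group G]

theorem hit_hit (x y a : G) : hit x (hit y a) = hit (x * y) a := by simp [hit, mul_assoc]

theorem one_hit (a : G) : hit 1 a = a := by simp [hit]

theorem hit_eq_iff_commutator (c a : G) : hit c a = a ↔ ⁅c, a⁆ = 1 := by
  rw [hit, commutatorElement_def, mul_inv_eq_one]

theorem hit_eq_hit_of_inv_mul {a b z : G} (h : hit (a⁻¹ * b) z = z) : hit b z = hit a z := by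
  rw [← hit_hit] at h
  conv_rhs => rw [← h]
  rw [hit_hit, mul_inv_cancel, one_hit]

theorem commutator_inv_left (c a : G) : ⁅c⁻¹, a⁆ = 1 ↔ ⁅c, a⁆ = 1 := by
  simp only [commutatorElement_eq_one_iff_commute, Commute.inv_left_iff]

/-- A form of the Hall–Witt identity: two of the three iterated commutators being trivial forces
the third one to be trivial. -/
theorem hit_commutator_eq_of_commutator_eq_one {x y z : G} (h1 : ⁅⁅z, y⁆, x⁆ = 1)
    (h2 : ⁅⁅y⁻¹, x⁆, z⁆ = 1) : hit ⁅z⁻¹, x⁻¹⁆ y = y := by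
  rw [← commutator_inv_left, commutatorElement_inv] at h1
  set c := ⁅y, z⁆ with hc
  have hcx : x * c⁻¹ = c⁻¹ * x :=
    ((commutatorElement_eq_one_iff_commute.1 h1).symm.inv_right).eq
  -- The second hypothesis says that `x ▷ y` and `y` conjugate `z` in the same way.
  have e1 : hit (hit x y) z = hit y z := by
    rw [← hit_eq_iff_commutator] at h2
    have : y⁻¹ * hit x y = ⁅y⁻¹, x⁆ := by simp [hit, commutatorElement_def, mul_assoc]
    rw [← this] at h2
    exact hit_eq_hit_of_inv_mul h2
  have e2 : hit z y = c⁻¹ * y := by simp [hc, hit, commutatorElement_def, mul_assoc]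
  have e3 : hit z (hit x y) = c⁻¹ * hit x y := by
    have : c = hit x y * z * (hit x y)⁻¹ * z⁻¹ := by
      rw [hc, commutatorElement_def]
      exact congrArg (· * z⁻¹) e1.symm
    rw [this]
    simp [hit, mul_assoc]
  have e4 : hit z (hit x y) = hit x (hit z y) := by
    rw [e3, e2]
    calc c⁻¹ * hit x y = c⁻¹ * x * y * x⁻¹ := by simp [hit, mul_assoc]
      _ = hit x (c⁻¹ * y) := by rw [← hcx]; simp [hit, mul_assoc]
  have e5 : hit ⁅z⁻¹, x⁻¹⁆ y = hit z⁻¹ (hit x⁻¹ (hit z (hit x y))) := by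
    simp only [hit_hit]
    congr 1
    simp [commutatorElement_def, mul_assoc]
  rw [e5, e4, hit_hit x⁻¹, inv_mul_cancel, one_hit, hit_hit, inv_mul_cancel, one_hit]

/-- The three strands of the Borromean braid return to their degrees exactly under the two
commutator conditions. -/
theorem commutator_conditions_iff (x y z : G) :
    (⁅⁅z, y⁆, x⁆ = 1 ∧ ⁅⁅y⁻¹, x⁆, z⁆ = 1) ↔
      hit (hit (hit x y) z * z⁻¹) x = x ∧ hit ((hit z⁻¹ x)⁻¹ * x) y = y ∧
        hit ((hit (hit z⁻¹ x)⁻¹ (hit x y))⁻¹ * hit x y) z = z := by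
  have d1 : (hit z⁻¹ x)⁻¹ * x = ⁅z⁻¹, x⁻¹⁆ := by simp [hit, commutatorElement_def, mul_assoc]
  have d2 : y⁻¹ * hit x y = ⁅y⁻¹, x⁆ := by simp [hit, commutatorElement_def, mul_assoc]
  have d3 : hit y z * z⁻¹ = ⁅z, y⁆⁻¹ := by simp [hit, commutatorElement_def, mul_assoc]
  have key : hit ((hit z⁻¹ x)⁻¹ * x) y = y →
      ((⁅⁅z, y⁆, x⁆ = 1 ∧ ⁅⁅y⁻¹, x⁆, z⁆ = 1) ↔ hit (hit (hit x y) z * z⁻¹) x = x ∧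
        hit ((hit (hit z⁻¹ x)⁻¹ (hit x y))⁻¹ * hit x y) z = z) := by
    intro h
    rw [hit_hit, h, d2, hit_eq_iff_commutator ⁅y⁻¹, x⁆ z]
    refine and_congr_left fun h2 => ?_
    have e : hit (hit x y) z = hit y z := by
      rw [← hit_eq_iff_commutator, ← d2] at h2
      exact hit_eq_hit_of_inv_mul h2
    rw [e, d3, hit_eq_iff_commutator, commutator_inv_left]
  constructor
  · intro h
    have h2 : hit ((hit z⁻¹ x)⁻¹ * x) y = y := by
      rw [d1]
      exact hit_commutator_eq_of_commutator_eq_one h.1 h.2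
    exact ⟨((key h2).1 h).1, h2, ((key h2).1 h).2⟩
  · intro h
    exact (key h.2.1).2 ⟨h.1, h.2.2⟩

end Conjugation

namespace ZVec

open GradedVec

variable {G : Type u} [Group G] [Fintype G] {ω : ThreeCocycle G}

/-- The trace of the action of `x` on `W_a`, as the trace of `act W x ∘ proj a` on all of `W`; it
is zero if `x` does not commute with `a`. -/
noncomputable def actTrace (W : ZVec ω) (x a : G) : ℂ :=
  LinearMap.trace ℂ _ (act W x ∘ₗ W.obj.proj a)

theorem actTrace_eq_zero (W : ZVec ω) {x a : G} (h : hit x a ≠ a) : actTrace W x a = 0 := by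
  have h0 : (act W x ∘ₗ W.obj.proj a) ∘ₗ W.obj.proj a = act W x ∘ₗ W.obj.proj a := by
    rw [LinearMap.comp_assoc]
    exact congrArg _ (W.obj.grading.idem a)
  have h1 : W.obj.proj a ∘ₗ act W x ∘ₗ W.obj.proj a = 0 := LinearMap.ext fun w =>
    (homog_act W x (W.obj.homog_proj a w)).proj_of_ne h.symm
  rw [actTrace, ← h0, LinearMap.trace_comp_comm', h1, map_zero]

theorem trace_act_act (W : ZVec ω) (x y a : G) :
    LinearMap.trace ℂ _ (act W x ∘ₗ act W y ∘ₗ W.obj.proj a) =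
      (ω.alpha a x y : ℂ) * actTrace W (x * y) a := by
  have h : act W x ∘ₗ act W y ∘ₗ W.obj.proj a =
      (ω.alpha a x y : ℂ) • (act W (x * y) ∘ₗ W.obj.proj a) :=
    LinearMap.ext fun w => act_act W x y (W.obj.homog_proj a w)
  rw [h, map_smul, smul_eq_mul, actTrace]

/-- The Borromean braid on a homogeneous component, before imposing that the degrees return. -/
theorem borromeanLin_comp_proj₃ (U V W : ZVec ω) (x y z : G) :
    borromeanLin U V W ∘ₗ proj₃ U V W x y z =
      ((ω.psi x (hit z⁻¹ x) (hit x y) z *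
        ω.psi (hit x y) (hit (hit z⁻¹ x)⁻¹ (hit x y)) (hit (hit x y) z) (hit z⁻¹ x) *
        ω.psi (hit (hit x y) z) (hit (hit (hit z⁻¹ x)⁻¹ (hit x y))⁻¹ (hit (hit x y) z))
          (hit (hit (hit x y) z) (hit z⁻¹ x)) (hit (hit z⁻¹ x)⁻¹ (hit x y)) : ℂˣ) : ℂ) •
      map₃
        (act U (hit (hit x y) z) ∘ₗ act U z⁻¹ ∘ₗ U.obj.proj x)
        (act V (hit z⁻¹ x)⁻¹ ∘ₗ act V x ∘ₗ V.obj.proj y)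
        (act W (hit (hit z⁻¹ x)⁻¹ (hit x y))⁻¹ ∘ₗ act W (hit x y) ∘ₗ W.obj.proj z) := by
  refine tensor_ext_left fun _ _ _ u v w _ _ _ => ?_
  have hu := U.obj.homog_proj x u
  have hv := V.obj.homog_proj y v
  have hw := W.obj.homog_proj z w
  rw [LinearMap.comp_apply, proj₃_apply, borromeanLin_apply, braidStep_apply U V W hu hv hw,
    map_smul, braidStep_apply V W U (homog_act V _ hv) hw (homog_act U _ hu), map_smul, map_smul,
    braidStep_apply W U V (homog_act W _ hw) (homog_act U _ hu)
      (homog_act V _ (homog_act V _ hv)), smul_smul, smul_smul]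
  push_cast
  rfl

/-- On the support given by the commutator conditions the degrees after each step simplify, which
produces the arguments of `ψ` and `α` in `Ω`; off the support one of the traces vanishes. -/
theorem localTensor_eq [DecidableEq G] (U V W : ZVec ω) (x y z : G) :
    localTensor U V W x y z = if ⁅⁅z, y⁆, x⁆ = 1 ∧ ⁅⁅y⁻¹, x⁆, z⁆ = 1 then
      (ω.Omega x y z : ℂ) * actTrace U ⁅y, z⁆ x * actTrace V ⁅z⁻¹, x⁻¹⁆ y * actTrace W ⁅y⁻¹, x⁆ z
      else 0 := by
  have d1 : (hit z⁻¹ x)⁻¹ * x = ⁅z⁻¹, x⁻¹⁆ := by simp [hit, commutatorElement_def, mul_assoc]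
  have d2 : y⁻¹ * hit x y = ⁅y⁻¹, x⁆ := by simp [hit, commutatorElement_def, mul_assoc]
  have d3 : hit y z * z⁻¹ = ⁅y, z⁆ := by simp [hit, commutatorElement_def, mul_assoc]
  have h := (congrArg (LinearMap.trace ℂ _) (borromeanLin_comp_proj₃ U V W x y z)).trans
    (map_smul (LinearMap.trace ℂ _) _ _)
  rw [smul_eq_mul] at h
  rw [trace_map₃, trace_act_act, trace_act_act, trace_act_act] at h
  refine h.trans ?_
  have hc := commutator_conditions_iff x y z
  split_ifs with c
  · obtain ⟨h1, h2, h3⟩ := hc.1 c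
    have e2 : hit (hit z⁻¹ x)⁻¹ (hit x y) = y := (hit_hit _ _ _).trans h2
    rw [e2] at h3
    have e3 : hit (hit x y) z = hit y z := hit_eq_hit_of_inv_mul h3
    rw [e3] at h1
    have e1 : hit (hit y z) (hit z⁻¹ x) = x := (hit_hit _ _ _).trans h1
    have e4 : hit y⁻¹ (hit y z) = z := by rw [hit_hit, inv_mul_cancel, one_hit]
    simp only [e1, e2, e3, e4, ← d1, ← d2, ← d3, ThreeCocycle.Omega]
    push_cast
    ring
  · rw [hc] at c
    by_cases h1 : hit (hit (hit x y) z * z⁻¹) x = x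
    · by_cases h2 : hit ((hit z⁻¹ x)⁻¹ * x) y = y
      · rw [actTrace_eq_zero W fun h3 => c ⟨h1, h2, h3⟩]
        simp
      · rw [actTrace_eq_zero V h2]
        simp
    · rw [actTrace_eq_zero U h1]
      simp

theorem sum_proj₃ (U V W : ZVec ω) :
    ∑ a : G, ∑ b : G, ∑ c : G, proj₃ U V W a b c = LinearMap.id := by
  refine tensor_ext_left fun x y z u v w hu hv hw => ?_
  simp only [LinearMap.sum_apply, proj₃_apply, LinearMap.id_apply]
  rw [Finset.sum_eq_single x, Finset.sum_eq_single y, Finset.sum_eq_single z]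
  · rw [hu, hv, hw]
  · intro c _ hc
    rw [hw.proj_of_ne hc]
    exact map_zero _
  · simp
  · intro b _ hb
    refine Finset.sum_eq_zero fun c _ => ?_
    rw [hv.proj_of_ne hb]
    exact (congrArg (fun t => tm t _) (map_zero _)).trans (LinearMap.map_zero₂ (tmHom _ _) _)
  · simp
  · intro a _ ha
    refine Finset.sum_eq_zero fun b _ => Finset.sum_eq_zero fun c _ => ?_
    rw [hu.proj_of_ne ha]
    exact (congrArg (fun t => tm t _) (LinearMap.map_zero₂ (tmHom _ _) _)).trans
      (LinearMap.map_zero₂ (tmHom _ _) _)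
  · simp

theorem borromeanTensor_eq_sum (U V W : ZVec ω) :
    borromeanTensor U V W = ∑ a : G, ∑ b : G, ∑ c : G, localTensor U V W a b c := by
  change LinearMap.trace ℂ _ (borromeanLin U V W) = _
  conv_lhs => rw [← LinearMap.comp_id (borromeanLin U V W), ← sum_proj₃]
  simp only [← Module.End.mul_eq_comp, Finset.mul_sum, map_sum, localTensor]

/-- The trace on the component of degree `p ▷ g` in terms of the trace on the component of
degree `g`. -/
theorem actTrace_hit (W : ZVec ω) (g p c : G) :
    actTrace W c (hit p g) = (ω.alpha g c p : ℂ) * ((ω.alpha g p (hit p⁻¹ c))⁻¹ : ℂˣ) *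
      actTrace W (hit p⁻¹ c) g := by
  let P := LinearEquiv.ofBijective _ (act_bijective W p)
  have h1 : (act W c ∘ₗ W.obj.proj (hit p g)) ∘ₗ act W p =
      ((ω.alpha g c p : ℂ) * ((ω.alpha g p (hit p⁻¹ c))⁻¹ : ℂˣ)) •
        (act W p ∘ₗ act W (hit p⁻¹ c) ∘ₗ W.obj.proj g) := by
    refine LinearMap.ext fun w => ?_
    have hw := W.obj.homog_proj g w
    change act W c (W.obj.proj _ (act W p w)) =
      ((ω.alpha g c p : ℂ) * ((ω.alpha g p (hit p⁻¹ c))⁻¹ : ℂˣ)) •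
        act W p (act W _ (W.obj.proj g w))
    have e : p * hit p⁻¹ c = c * p := by simp [hit, mul_assoc]
    rw [proj_act, act_act W c p hw, act_act W p _ hw, smul_smul, e, mul_assoc, Units.inv_mul,
      mul_one]
  rw [actTrace, actTrace, ← smul_eq_mul, ← map_smul,
    ← LinearMap.trace_conj' (_ • act W (hit p⁻¹ c) ∘ₗ W.obj.proj g) P]
  congr 1
  refine LinearMap.ext fun t => ?_
  obtain ⟨t, rfl⟩ := P.surjective t
  rw [LinearEquiv.conj_apply_apply, P.symm_apply_apply]
  refine (LinearMap.congr_fun h1 t).trans ?_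
  exact (map_smul (act W p) _ _).symm

/-- `p ▷ χ` is the character of the component of degree `p ▷ g`. -/
theorem conjChar_eq_actTrace {W : ZVec ω} {g : G} {χ : G → ℂ} (hW : IsSimpleWith W g χ)
    {p c : G} (hc : hit c (hit p g) = hit p g) :
    ω.conjChar g p χ c = actTrace W c (hit p g) := by
  have hmem : hit p⁻¹ c ∈ Subgroup.centralizer {g} := by
    rw [Subgroup.mem_centralizer_singleton_iff]
    have h := congrArg (hit p⁻¹) hc
    rw [hit_hit, hit_hit, hit_hit, inv_mul_cancel, one_hit] at h
    have e : p⁻¹ * c * p = hit p⁻¹ c := by simp [hit]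
    rw [e] at h
    exact mul_inv_eq_iff_eq_mul.1 h
  rw [actTrace_hit, ThreeCocycle.conjChar, hW.2.2 _ hmem, actTrace]

end ZVec

/-! ### Splitting idempotents in the center, and the support of simple objects -/

namespace RightCenter

variable {C : Type u} [Category.{v} C] [MonoidalCategory C]

/-- A retract in `C` of an object `X` of the center inherits a half-braiding, provided that the
corresponding idempotent of `X` is compatible with the half-braiding of `X`. -/
def retract (X : RightCenter C) {Y : C} (i : Y ⟶ X.obj) (r : X.obj ⟶ Y) (hir : i ≫ r = 𝟙 Y)
    (he : ∀ V : C, (V ◁ (r ≫ i)) ≫ (X.hb.σ V).hom = (X.hb.σ V).hom ≫ ((r ≫ i) ▷ V)) :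
    RightCenter C where
  obj := Y
  hb :=
    { σ := fun V =>
        { hom := (V ◁ i) ≫ (X.hb.σ V).hom ≫ (r ▷ V)
          inv := (i ▷ V) ≫ (X.hb.σ V).inv ≫ (V ◁ r)
          hom_inv_id := by
            have h : (X.hb.σ V).hom ≫ r ▷ V ≫ i ▷ V = V ◁ r ≫ V ◁ i ≫ (X.hb.σ V).hom := by
              rw [← comp_whiskerRight, ← he, whiskerLeft_comp, Category.assoc]
            calc ((V ◁ i) ≫ (X.hb.σ V).hom ≫ (r ▷ V)) ≫ (i ▷ V) ≫ (X.hb.σ V).inv ≫ (V ◁ r)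
                = V ◁ i ≫ ((X.hb.σ V).hom ≫ r ▷ V ≫ i ▷ V) ≫ (X.hb.σ V).inv ≫ V ◁ r := by
                  simp only [Category.assoc]
              _ = V ◁ (i ≫ r) ≫ V ◁ (i ≫ r) := by
                  rw [h]
                  simp only [Category.assoc, Iso.hom_inv_id_assoc, whiskerLeft_comp]
              _ = 𝟙 _ := by
                  rw [hir, whiskerLeft_id, Category.comp_id]
          inv_hom_id := by
            have h : (X.hb.σ V).inv ≫ V ◁ r ≫ V ◁ i = r ▷ V ≫ i ▷ V ≫ (X.hb.σ V).inv := by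
              rw [Iso.inv_comp_eq, ← whiskerLeft_comp, ← comp_whiskerRight_assoc, ← Category.assoc,
                Iso.eq_comp_inv, he]
            calc ((i ▷ V) ≫ (X.hb.σ V).inv ≫ (V ◁ r)) ≫ (V ◁ i) ≫ (X.hb.σ V).hom ≫ (r ▷ V)
                = i ▷ V ≫ ((X.hb.σ V).inv ≫ V ◁ r ≫ V ◁ i) ≫ (X.hb.σ V).hom ≫ r ▷ V := by
                  simp only [Category.assoc]
              _ = (i ≫ r) ▷ V ≫ (i ≫ r) ▷ V := by
                  rw [h]
                  simp only [Category.assoc, Iso.inv_hom_id_assoc, comp_whiskerRight]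
              _ = 𝟙 _ := by
                  rw [hir, id_whiskerRight, Category.comp_id] }
      naturality := fun {V V'} f => by
        rw [← whisker_exchange_assoc, ← Category.assoc (f ▷ X.obj), X.hb.naturality,
          Category.assoc, Category.assoc, Category.assoc, whisker_exchange]
      monoidal := fun V V' => by
        have h : (V ◁ r) ▷ V' ≫ (V ◁ i) ▷ V' ≫ (X.hb.σ V).hom ▷ V' ≫ r ▷ V ▷ V' =
            (X.hb.σ V).hom ▷ V' ≫ r ▷ V ▷ V' := by
          simp only [← comp_whiskerRight]
          congr 1
          rw [← whiskerLeft_comp_assoc, ← Category.assoc, he, Category.assoc, ← comp_whiskerRight,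
            Category.assoc, hir, Category.comp_id]
        dsimp only
        rw [X.hb.monoidal]
        simp only [whiskerLeft_comp, comp_whiskerRight, Category.assoc]
        rw [associator_inv_naturality_middle_assoc, reassoc_of% h]
        simp }

/-- A compatible retract of a simple object of the center is zero or everything. -/
theorem eq_id_of_simple [Limits.HasZeroMorphisms (RightCenter C)] (X : RightCenter C) [Simple X]
    {Y : C} (i : Y ⟶ X.obj) (r : X.obj ⟶ Y) (hir : i ≫ r = 𝟙 Y)
    (he : ∀ V : C, (V ◁ (r ≫ i)) ≫ (X.hb.σ V).hom = (X.hb.σ V).hom ≫ ((r ≫ i) ▷ V))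
    (hne : i ≠ Hom.f (0 : retract X i r hir he ⟶ X)) : r ≫ i = 𝟙 X.obj := by
  let ι : retract X i r hir he ⟶ X := Hom.mk i fun V => by
    change V ◁ i ≫ _ = ((V ◁ i) ≫ (X.hb.σ V).hom ≫ (r ▷ V)) ≫ i ▷ V
    rw [Category.assoc, Category.assoc, ← comp_whiskerRight, ← he, ← whiskerLeft_comp_assoc,
      ← Category.assoc i, hir, Category.id_comp]
  have hcancel : ∀ {Z : C} (a b : Z ⟶ Y), a ≫ i = b ≫ i → a = b := fun a b h => by
    rw [← Category.comp_id a, ← hir, ← Category.assoc, h, Category.assoc, hir, Category.comp_id]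
  have hmono : Mono ι := ⟨fun a b h => Hom.ext (hcancel _ _ (congrArg Hom.f h))⟩
  have hiso : IsIso ι := (Simple.mono_isIso_iff_nonzero ι).2 fun h => hne (congrArg Hom.f h)
  obtain ⟨j, h⟩ : ∃ j : X.obj ⟶ Y, j ≫ i = 𝟙 X.obj :=
    ⟨Hom.f (inv ι), congrArg Hom.f (IsIso.inv_hom_id ι)⟩
  rw [← Category.id_comp (r ≫ i), ← h, Category.assoc, ← Category.assoc i, hir, Category.id_comp]

end RightCenter

namespace GradedVec

variable {G : Type u} [Group G] [Fintype G] {ω : ThreeCocycle G}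

/-- The image of an idempotent endomorphism of a graded vector space. -/
noncomputable def image {V : GradedVec ω} (E : V ⟶ V) (hE : E ≫ E = E) : GradedVec ω where
  carrier := LinearMap.range (lin E)
  proj a := (lin E).rangeRestrict ∘ₗ V.proj a ∘ₗ (LinearMap.range (lin E)).subtype
  grading := by
    have hfix : ∀ v : LinearMap.range (lin E), lin E v = v := by
      rintro ⟨_, v, rfl⟩
      exact LinearMap.congr_fun (congrArg lin hE) v
    have hval : ∀ a (v : LinearMap.range (lin E)),
        (((lin E).rangeRestrict ∘ₗ V.proj a ∘ₗ (LinearMap.range (lin E)).subtype) v : V.carrier) =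
          V.proj a v := fun a v => by
      change lin E (V.proj a v) = V.proj a v
      rw [lin_proj, hfix]
    refine { idem := fun a => ?_, ortho := fun a b hab => ?_, complete := ?_ }
    · refine LinearMap.ext fun v => Subtype.ext ?_
      rw [Module.End.mul_apply, hval, hval]
      exact LinearMap.congr_fun (V.grading.idem a) v
    · refine LinearMap.ext fun v => Subtype.ext ?_
      change (((_ * _ : Module.End ℂ _) v : LinearMap.range (lin E)) : V.carrier) = 0
      rw [Module.End.mul_apply, hval, hval]
      exact LinearMap.congr_fun (V.grading.ortho hab) v
    · refine LinearMap.ext fun v => Subtype.ext ?_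
      rw [LinearMap.sum_apply, AddSubmonoidClass.coe_finsetSum]
      simp only [hval]
      exact V.sum_proj v

/-- The inclusion of the image of an idempotent. -/
noncomputable def imageι {V : GradedVec ω} (E : V ⟶ V) (hE : E ≫ E = E) : image E hE ⟶ V :=
  Hom.mk (LinearMap.range (lin E)).subtype fun a => LinearMap.ext fun v => by
    obtain ⟨_, v, rfl⟩ := v
    change lin E (V.proj a (lin E v)) = V.proj a (lin E v)
    rw [← lin_proj]
    exact LinearMap.congr_fun (congrArg lin hE) _

/-- The projection onto the image of an idempotent. -/
noncomputable def imageπ {V : GradedVec ω} (E : V ⟶ V) (hE : E ≫ E = E) : V ⟶ image E hE :=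
  Hom.mk (lin E).rangeRestrict fun a => LinearMap.ext fun v => Subtype.ext <| by
    change lin E (V.proj a v) = lin E (V.proj a (lin E v))
    rw [← lin_proj]
    exact (LinearMap.congr_fun (congrArg lin hE) _).symm

theorem imageι_imageπ {V : GradedVec ω} (E : V ⟶ V) (hE : E ≫ E = E) :
    imageι E hE ≫ imageπ E hE = 𝟙 _ :=
  hom_ext <| LinearMap.ext fun v => Subtype.ext <| by
    obtain ⟨_, v, rfl⟩ := v
    exact LinearMap.congr_fun (congrArg lin hE) v

theorem imageπ_imageι {V : GradedVec ω} (E : V ⟶ V) (hE : E ≫ E = E) :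
    imageπ E hE ≫ imageι E hE = E := rfl

open Classical in
/-- The linear map underlying `cut`. -/
noncomputable def cutLin (V : GradedVec ω) (S : Set G) : Module.End ℂ V.carrier :=
  ∑ a : G, if a ∈ S then V.proj a else 0

open Classical in
theorem cutLin_apply (V : GradedVec ω) (S : Set G) {g : G} {v : V.carrier} (hv : V.Homog g v) :
    cutLin V S v = if g ∈ S then v else 0 := by
  rw [cutLin, LinearMap.sum_apply, Finset.sum_eq_single g]
  · split_ifs
    · exact hv
    · rfl
  · intro b _ hb
    split_ifs
    · exact hv.proj_of_ne hb
    · rfl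
  · simp

/-- The projection of a graded vector space onto its components with degrees in `S`. -/
noncomputable def cut (V : GradedVec ω) (S : Set G) : V ⟶ V :=
  homOfHomog (cutLin V S) fun g v hv => by
    rw [cutLin_apply V S hv]
    split_ifs
    · exact hv
    · exact map_zero _

open Classical in
theorem cut_apply (V : GradedVec ω) (S : Set G) {g : G} {v : V.carrier} (hv : V.Homog g v) :
    lin (cut V S) v = if g ∈ S then v else 0 :=
  cutLin_apply V S hv

theorem cut_cut (V : GradedVec ω) (S : Set G) : cut V S ≫ cut V S = cut V S :=
  hom_ext <| lin_ext fun g v hv => by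
    classical
    rw [lin_comp, LinearMap.comp_apply, cut_apply V S hv]
    split_ifs with h
    · rw [cut_apply V S hv, if_pos h]
    · exact map_zero _

end GradedVec

namespace ZVec

open GradedVec

variable {G : Type u} [Group G] [Fintype G] {ω : ThreeCocycle G}

/-- The projection onto the components with degrees in a conjugation-invariant set is compatible
with the half-braiding. -/
theorem cut_comm (W : ZVec ω) {S : Set G} (hS : ∀ x a, hit x a ∈ S ↔ a ∈ S) (V : GradedVec ω) :
    (V ◁ cut W.obj S) ≫ (W.hb.σ V).hom = (W.hb.σ V).hom ≫ (cut W.obj S ▷ V) :=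
  hom_ext <| tensor_ext fun x a v w hv hw => by
    classical
    change sig V W (tm v (lin (cut W.obj S) w)) = lin (tensorMap (cut W.obj S) (𝟙 V))
      (sig V W (tm v w))
    rw [sig_apply W hv, sig_apply W hv, tensorMap_apply, cut_apply _ _ hw,
      cut_apply _ _ (homog_act W x hw), lin_id, LinearMap.id_apply]
    simp only [hS]
    split_ifs
    · rfl
    · rw [map_zero]

/-- The degrees occurring in a simple object of the center form a single conjugacy class. -/
theorem isConj_of_proj_ne_zero (W : ZVec ω) [Simple W] {g a : G} (hg : W.obj.proj g ≠ 0)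
    (ha : W.obj.proj a ≠ 0) : IsConj g a := by
  by_contra hn
  let S : Set G := {b | IsConj g b}
  have hS : ∀ x a, hit x a ∈ S ↔ a ∈ S := fun x a => by
    have h : IsConj a (hit x a) := isConj_iff.2 ⟨x, rfl⟩
    exact ⟨fun h' => IsConj.trans h' h.symm, fun h' => IsConj.trans h' h⟩
  have hE := cut_cut W.obj S
  have key := RightCenter.eq_id_of_simple W (imageι _ hE) (imageπ _ hE) (imageι_imageπ _ hE)
    (cut_comm W hS) (fun h0 => hg (LinearMap.ext fun v => by
      have h1 : lin (cut W.obj S) (W.obj.proj g v) = 0 :=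
        LinearMap.congr_fun (congrArg (fun f => lin (imageπ _ hE ≫ f)) h0) (W.obj.proj g v)
      rw [cut_apply _ _ (W.obj.homog_proj g v)] at h1
      rwa [if_pos (show g ∈ S from IsConj.refl g)] at h1))
  refine ha (LinearMap.ext fun v => ?_)
  have h1 := LinearMap.congr_fun (congrArg lin key) (W.obj.proj a v)
  rw [imageπ_imageι, cut_apply _ _ (W.obj.homog_proj a v), if_neg (show a ∉ S from hn)] at h1
  exact h1.symm

end ZVec

/-! ### Summation over conjugacy classes and the formula -/

section ConjugacySum

variable {G : Type u} [Group G] [Fintype G]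

open Classical in
theorem card_hit_eq (g a : G) (ha : IsConj g a) :
    (Finset.univ.filter fun p => hit p g = a).card =
      (Finset.univ.filter fun p => hit p g = g).card := by
  obtain ⟨s, hs⟩ := isConj_iff.1 ha
  have hs : hit s g = a := hs
  refine Finset.card_bij' (fun p _ => s⁻¹ * p) (fun p _ => s * p) ?_ ?_ ?_ ?_
  · intro p hp
    simp only [Finset.mem_filter, Finset.mem_univ, true_and] at hp ⊢
    rw [← hit_hit, hp, ← hs, hit_hit, inv_mul_cancel, one_hit]
  · intro p hp
    simp only [Finset.mem_filter, Finset.mem_univ, true_and] at hp ⊢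
    rw [← hit_hit, hp, hs]
  · simp
  · simp

/-- A sum of a function supported on the conjugacy class of `g`, as a sum over conjugators. -/
theorem sum_eq_sum_hit (g : G) (f : G → ℂ) (hf : ∀ a, ¬ IsConj g a → f a = 0) :
    ∑ a, f a = ((conjugatesOf g).ncard : ℂ) / Fintype.card G * ∑ p, f (hit p g) := by
  classical
  set N := (Finset.univ.filter fun p => hit p g = g).card with hN
  have key : ∀ f : G → ℂ, (∀ a, ¬ IsConj g a → f a = 0) → ∑ p, f (hit p g) = N * ∑ a, f a := by
    intro f hf
    rw [← Finset.sum_fiberwise Finset.univ (fun p => hit p g), Finset.mul_sum]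
    refine Finset.sum_congr rfl fun a _ => ?_
    rw [Finset.sum_congr rfl (g := fun _ => f a) fun p hp => by rw [(Finset.mem_filter.1 hp).2],
      Finset.sum_const, nsmul_eq_mul]
    by_cases ha : IsConj g a
    · rw [card_hit_eq g a ha]
    · rw [hf a ha, mul_zero, mul_zero]
  -- The indicator function of the class gives `|G| = N · |class|`.
  have h1 := key (fun a => if IsConj g a then 1 else 0) fun a ha => if_neg ha
  have h2 : ∀ p, IsConj g (hit p g) := fun p => isConj_iff.2 ⟨p, rfl⟩
  have h3 : (Finset.univ.filter fun a => IsConj g a).card = (conjugatesOf g).ncard := by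
    rw [← Set.ncard_coe_finset]
    congr 1
    ext a
    simp [conjugatesOf]
  simp only [h2, if_true, Finset.sum_const, Finset.card_univ, nsmul_eq_mul, mul_one,
    Finset.sum_boole, h3] at h1
  have hG : (Fintype.card G : ℂ) ≠ 0 := Nat.cast_ne_zero.2 Fintype.card_ne_zero
  rw [key f hf, ← mul_assoc, div_mul_eq_mul_div, mul_comm _ (N : ℂ), ← h1, div_self hG, one_mul]

end ConjugacySum

namespace ZVec

open GradedVec

variable {G : Type u} [Group G] [Fintype G] {ω : ThreeCocycle G}

theorem IsSimpleWith.proj_eq_zero {W : ZVec ω} {g : G} {χ : G → ℂ} (hW : IsSimpleWith W g χ)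
    {a : G} (ha : ¬ IsConj g a) : W.obj.proj a = 0 := by
  have := hW.1
  by_contra h
  exact ha (isConj_of_proj_ne_zero W hW.2.1 h)

theorem actTrace_of_proj_eq_zero {W : ZVec ω} {a : G} (h : W.obj.proj a = 0) (x : G) :
    actTrace W x a = 0 := by
  rw [actTrace, h, LinearMap.comp_zero, map_zero]

theorem localTensor_eq_zero {U V W : ZVec ω} {a b c : G}
    (h : U.obj.proj a = 0 ∨ V.obj.proj b = 0 ∨ W.obj.proj c = 0) :
    localTensor U V W a b c = 0 := by
  classical
  rw [localTensor_eq]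
  split_ifs
  · rcases h with h | h | h
    · rw [actTrace_of_proj_eq_zero h]; ring
    · rw [actTrace_of_proj_eq_zero h]; ring
    · rw [actTrace_of_proj_eq_zero h]; ring
  · rfl

/-- By invariance under simultaneous conjugation, the degree of the third strand can be kept
fixed in the sum over conjugators. -/
theorem sum_localTensor_hit (U V W : ZVec ω) (g h k : G) :
    ∑ p : G, ∑ q : G, ∑ r : G, localTensor U V W (hit p g) (hit q h) (hit r k) =
      Fintype.card G * ∑ p : G, ∑ q : G, localTensor U V W (hit p g) (hit q h) k := by
  have hr : ∀ r : G, ∑ p : G, ∑ q : G, localTensor U V W (hit p g) (hit q h) (hit r k) =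
      ∑ p : G, ∑ q : G, localTensor U V W (hit p g) (hit q h) k := fun r => by
    rw [← Equiv.sum_comp (Equiv.mulLeft r)]
    refine Finset.sum_congr rfl fun p _ => ?_
    rw [← Equiv.sum_comp (Equiv.mulLeft r)]
    refine Finset.sum_congr rfl fun q _ => ?_
    rw [Equiv.coe_mulLeft, ← hit_hit, ← hit_hit, localTensor_hit]
  calc _ = ∑ r : G, ∑ p : G, ∑ q : G, localTensor U V W (hit p g) (hit q h) (hit r k) :=
        (Finset.sum_congr rfl fun p _ => Finset.sum_comm).trans Finset.sum_comm
    _ = _ := by simp only [hr, Finset.sum_const, Finset.card_univ, nsmul_eq_mul]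

theorem borromeanTensor_eq_sum_hit {U V W : ZVec ω} {g h k : G} {χ₁ χ₂ χ₃ : G → ℂ}
    (hU : IsSimpleWith U g χ₁) (hV : IsSimpleWith V h χ₂) (hW : IsSimpleWith W k χ₃) :
    borromeanTensor U V W =
      ((conjugatesOf g).ncard * (conjugatesOf h).ncard * (conjugatesOf k).ncard : ℂ) /
          (Fintype.card G : ℂ) ^ 2 *
        ∑ p : G, ∑ q : G, localTensor U V W (hit p g) (hit q h) k := by
  have hG : (Fintype.card G : ℂ) ≠ 0 := Nat.cast_ne_zero.2 Fintype.card_ne_zero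
  have h3 : ∀ a b, ∑ c, localTensor U V W a b c = ((conjugatesOf k).ncard : ℂ) /
      Fintype.card G * ∑ r, localTensor U V W a b (hit r k) := fun a b =>
    sum_eq_sum_hit k _ fun c hc => localTensor_eq_zero (.inr (.inr (hW.proj_eq_zero hc)))
  have h2 : ∀ a, ∑ b, ∑ c, localTensor U V W a b c = ((conjugatesOf h).ncard : ℂ) /
      Fintype.card G * ∑ q, ∑ c, localTensor U V W a (hit q h) c := fun a =>
    sum_eq_sum_hit h _ fun b hb => Finset.sum_eq_zero fun c _ =>
      localTensor_eq_zero (.inr (.inl (hV.proj_eq_zero hb)))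
  have h1 : ∑ a, ∑ b, ∑ c, localTensor U V W a b c = ((conjugatesOf g).ncard : ℂ) /
      Fintype.card G * ∑ p, ∑ b, ∑ c, localTensor U V W (hit p g) b c :=
    sum_eq_sum_hit g _ fun a ha => Finset.sum_eq_zero fun b _ => Finset.sum_eq_zero fun c _ =>
      localTensor_eq_zero (.inl (hU.proj_eq_zero ha))
  rw [borromeanTensor_eq_sum, h1]
  simp only [h2]
  simp only [h3, ← Finset.mul_sum]
  rw [sum_localTensor_hit]
  field_simp

end ZVec

theorem mainTheorem3 {G : Type*} [Group G] [Fintype G] [DecidableEq G] (ω : ThreeCocycle G)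
    (U V W : ZVec ω) (g h k : G) (χ₁ χ₂ χ₃ : G → ℂ)
    (hU : ZVec.IsSimpleWith U g χ₁) (hV : ZVec.IsSimpleWith V h χ₂)
    (hW : ZVec.IsSimpleWith W k χ₃) :
    ZVec.borromeanTensor U V W =
      ((conjugatesOf g).ncard * (conjugatesOf h).ncard * (conjugatesOf k).ncard : ℂ) /
          (Fintype.card G : ℂ) ^ 2 *
        ∑ p : G, ∑ q : G,
          if ⁅⁅k, hit q h⁆, hit p g⁆ = 1 ∧
              ⁅⁅(hit q h)⁻¹, hit p g⁆, k⁆ = 1 then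
            (ω.Omega (hit p g) (hit q h) k : ℂ) *
              ω.conjChar g p χ₁ ⁅hit q h, k⁆ *
              ω.conjChar h q χ₂ ⁅k⁻¹, (hit p g)⁻¹⁆ *
              χ₃ ⁅(hit q h)⁻¹, hit p g⁆
          else 0 := by
  rw [ZVec.borromeanTensor_eq_sum_hit hU hV hW]
  congr 1
  refine Finset.sum_congr rfl fun p _ => Finset.sum_congr rfl fun q _ => ?_
  rw [ZVec.localTensor_eq]
  refine if_ctx_congr Iff.rfl (fun hc => ?_) fun _ => rfl
  have h1 : hit ⁅hit q h, k⁆ (hit p g) = hit p g := by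
    rw [hit_eq_iff_commutator, ← commutator_inv_left, commutatorElement_inv]
    exact hc.1
  have h2 := hit_commutator_eq_of_commutator_eq_one hc.1 hc.2
  have h3 : ⁅(hit q h)⁻¹, hit p g⁆ ∈ Subgroup.centralizer {k} :=
    Subgroup.mem_centralizer_singleton_iff.2 (commutatorElement_eq_one_iff_mul_comm.1 hc.2)
  rw [ZVec.conjChar_eq_actTrace hU h1, ZVec.conjChar_eq_actTrace hV h2, hW.2.2 _ h3]
  rfl
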